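/- Let $G$ be a finite group with the following property: any two non-linear irreducible complex characters $\chi,\psi$ of $G$ with $\chi(1)=\psi(1)$ are Galois conjugate, that is, there are a positive multiple $n$ of $|G|$ and an automorphism $\alpha\in\mathrm{Gal}(\mathbb{Q}_n|\mathbb{Q})$, where $\mathbb{Q}_n$ is the $n$-th cyclotomic field, such that $\psi(g)=\chi(g)^{\alpha}$ for all $g\in G$. Suppose that $G$ is solvable and not nilpotent, and let $K=G_\infty$ be the nilpotent residual of $G$, i.e. the smallest term of its lower central series. Then $G=KL$ is a Frobenius group with Frobenius kernel $K$ and Frobenius complement $L$ (so $K\cap L=1$), and either $L$ is cyclic or $L\cong Q_8$, the quaternion group of order $8$. -/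

import Mathlib

/-- `χ` is an irreducible complex character of `G`: the character of an irreducible
representation of `G` on some finite-dimensional complex vector space `ℂⁿ`. -/
def IsIrrChar (G : Type*) [Group G] (χ : G → ℂ) : Prop :=
  ∃ (n : ℕ) (ρ : Representation ℂ G (Fin n → ℂ)), ρ.IsIrreducible ∧ χ = ρ.character

/-- The `n`-th cyclotomic field `ℚ_n`, as the subfield of `ℂ` generated by the `n`-th roots of
unity. -/
noncomputable def cyclotomicSubfield (n : ℕ) : IntermediateField ℚ ℂ :=
  IntermediateField.adjoin ℚ {z : ℂ | z ^ n = 1}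

/-- `χ` and `ψ` are Galois conjugate: for some positive multiple `n` of `|G|`, they take values in
`ℚ_n` and some `α` in `Gal(ℚ_n | ℚ)` satisfies `ψ(g) = χ(g)^α` for all `g`. (For irreducible
characters the choice of `n` is immaterial.) -/
def GaloisConjugate {G : Type*} [Group G] (χ ψ : G → ℂ) : Prop :=
  ∃ n : ℕ, 0 < n ∧ Nat.card G ∣ n ∧
    ∃ α : cyclotomicSubfield n ≃ₐ[ℚ] cyclotomicSubfield n,
      ∀ g : G, ∃ z : cyclotomicSubfield n, (z : ℂ) = χ g ∧ (α z : ℂ) = ψ g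

/-- The class of GC*-groups: any two non-linear irreducible characters of the same degree are
Galois conjugate. The degree of a character `χ` is `χ 1`, and `χ` is linear if `χ 1 = 1`. -/
def IsGCStar (G : Type*) [Group G] : Prop :=
  ∀ χ ψ : G → ℂ, IsIrrChar G χ → IsIrrChar G ψ → χ 1 ≠ 1 → ψ 1 ≠ 1 → χ 1 = ψ 1 →
    GaloisConjugate χ ψ

/-- The intersection of the (descending) lower central series of `G`; for a finite group this is
its smallest term, the nilpotent residual. -/
def nilpotentResidual (G : Type*) [Group G] : Subgroup G :=
  ⨅ n : ℕ, (⊤ : Subgroup G).lowerCentralSeries n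

/-- The (finite) group `G` is a Frobenius group with Frobenius complement `L` and Frobenius
kernel `K`: `L` is a nontrivial proper subgroup meeting each conjugate `gLg⁻¹`, `g ∉ L`, trivially,
and `K` consists of `1` together with the elements lying in no conjugate of `L`. -/
structure IsFrobeniusGroup {G : Type*} [Group G] (K L : Subgroup G) : Prop where
  ne_bot : L ≠ ⊥
  ne_top : L ≠ ⊤
  inf_conj : ∀ g : G, g ∉ L → L ⊓ L.map (MulAut.conj g).toMonoidHom = ⊥
  mem_kernel : ∀ x : G, x ∈ K ↔ x = 1 ∨ ∀ g : G, x ∉ L.map (MulAut.conj g).toMonoidHom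

/-! ### Irreducible complex representations, and how they separate the group algebra -/

section Representations

universe u

open Representation Module

variable {G : Type*} [Group G]

/-! Galois conjugation fixes integers, and the sum of a character over a subgroup `H` is `|H|` times
the dimension of the `H`-invariants. So in a `GC*`-group two nonlinear irreducible representations
of equal degree have equally many `H`-invariants, for every `H` (`IsGCStar.finrank_invariants_eq`).
This is the only way Galois conjugacy is used. Write `R` for the nilpotent residual and `G'` for the
commutator subgroup.

If a normal subgroup `N` is complemented by `M`, a linear character `θ` of `N` with stabilizer `T`
in `M`, together with a linear character `ψ` of `T`, gives an irreducible representation whose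
degree is the size of the `M`-orbit of `θ`. It has `M`-invariants exactly when `ψ = 1`. For solvable
`G` this forces `T = 1` or `T = M` (`IsGCStar.linearCharacterStabilizer_eq_bot`). Induction on `|G|`
through a minimal normal subgroup inside `R` then shows that `R` is a Hall subgroup, so
Schur–Zassenhaus supplies a complement `L`.

Since `[R, G] = R`, no nontrivial linear character of `R` is `L`-invariant, so `L` acts freely on
the nontrivial ones, and abelian subgroups of `L` are cyclic. The group `L ≅ G/R` is nilpotent and
again `GC*`. If it is not abelian, it is a `p`-group with cyclic abelian subgroups, hence
generalized quaternion. Its irreducible degrees are at most 2, and comparing invariants of the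
central involution leaves only `Q₈`.

For the Frobenius property, let `t ∈ L` lie outside `G'` with `L ∩ tG'` inside the class of `t`.
Twisting by linear characters makes every nonlinear irreducible character vanish at `t`, so the
class of `t` is all of `tG'`. Counting then gives `C_R(t) = 1`. This covers every nontrivial element
of a cyclic `L` and all noncentral elements of `Q₈`. The central involution `z` is handled
separately: two generators of order 4 both invert `C_R(z)`, so their product centralizes it. -/

theorem Representation.isIrreducible_iff_forall_stable {V : Type*} [AddCommGroup V] [Module ℂ V]
    (ρ : Representation ℂ G V) :
    ρ.IsIrreducible ↔ Nontrivial V ∧ ∀ W : Submodule ℂ V, (∀ g, ∀ v ∈ W, ρ g v ∈ W) →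
      W = ⊥ ∨ W = ⊤ := by
  constructor
  · intro h
    refine ⟨?_, fun W hW => ?_⟩
    · by_contra hV
      rw [not_nontrivial_iff_subsingleton] at hV
      exact (bot_ne_top (α := Subrepresentation ρ))
        (Subrepresentation.toSubmodule_injective (Subsingleton.elim _ _))
    · rcases eq_bot_or_eq_top (⟨W, fun g v hv => hW g v hv⟩ : Subrepresentation ρ) with h | h
      · exact Or.inl (congrArg Subrepresentation.toSubmodule h)
      · exact Or.inr (congrArg Subrepresentation.toSubmodule h)
  · rintro ⟨hV, h⟩
    refine { exists_pair_ne := ⟨⊥, ⊤, fun e => ?_⟩, eq_bot_or_eq_top := fun W => ?_ }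
    · have : (⊥ : Submodule ℂ V) = ⊤ := congrArg Subrepresentation.toSubmodule e
      exact bot_ne_top this
    · rcases h W.toSubmodule (fun g v hv => W.apply_mem_toSubmodule g hv) with h | h
      · exact Or.inl (Subrepresentation.toSubmodule_injective h)
      · exact Or.inr (Subrepresentation.toSubmodule_injective h)

/-- The representation on `W` transported along a linear equivalence `V ≃ W`. -/
def Representation.transport {V W : Type*} [AddCommGroup V] [Module ℂ V] [AddCommGroup W]
    [Module ℂ W] (ρ : Representation ℂ G V) (e : V ≃ₗ[ℂ] W) : Representation ℂ G W where
  toFun g := e.conj (ρ g)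
  map_one' := by simp [Module.End.one_eq_id]
  map_mul' x y := by ext; simp

theorem Representation.transport_apply {V W : Type*} [AddCommGroup V] [Module ℂ V]
    [AddCommGroup W] [Module ℂ W] (ρ : Representation ℂ G V) (e : V ≃ₗ[ℂ] W) (g : G) :
    ρ.transport e g = e.conj (ρ g) := rfl

theorem Representation.character_transport {V W : Type*} [AddCommGroup V] [Module ℂ V]
    [AddCommGroup W] [Module ℂ W] (ρ : Representation ℂ G V) (e : V ≃ₗ[ℂ] W) :
    (ρ.transport e).character = ρ.character := by
  funext g
  exact LinearMap.trace_conj' (ρ g) e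

theorem Representation.IsIrreducible.transport {V W : Type*} [AddCommGroup V] [Module ℂ V]
    [AddCommGroup W] [Module ℂ W] {ρ : Representation ℂ G V} (h : ρ.IsIrreducible)
    (e : V ≃ₗ[ℂ] W) : (ρ.transport e).IsIrreducible := by
  rw [isIrreducible_iff_forall_stable] at h ⊢
  obtain ⟨hV, h⟩ := h
  refine ⟨e.symm.toEquiv.nontrivial, fun U hU => ?_⟩
  have hst : ∀ g, ∀ v ∈ U.comap e.toLinearMap, ρ g v ∈ U.comap e.toLinearMap := by
    intro g v hv
    simpa [transport_apply, LinearEquiv.conj_apply] using hU g (e v) hv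
  rcases h _ hst with h | h
  · left
    rw [eq_bot_iff]
    intro u hu
    have : e.symm u ∈ U.comap e.toLinearMap := by simpa using hu
    rw [h, Submodule.mem_bot] at this
    simpa using this
  · right
    rw [eq_top_iff]
    intro u _
    have : e.symm u ∈ U.comap e.toLinearMap := by rw [h]; trivial
    simpa using this

theorem Representation.IsIrreducible.isIrrChar {V : Type*} [AddCommGroup V] [Module ℂ V]
    [FiniteDimensional ℂ V] {ρ : Representation ℂ G V} (h : ρ.IsIrreducible) :
    IsIrrChar G ρ.character :=
  ⟨finrank ℂ V, ρ.transport (finBasis ℂ V).equivFun, h.transport _,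
    (ρ.character_transport _).symm⟩

variable [Finite G]

/-- The action on a representation of the element `∑ x g • g` of the group algebra. -/
noncomputable def Representation.sumSMul {V : Type*} [AddCommGroup V] [Module ℂ V]
    (ρ : Representation ℂ G V) (x : G → ℂ) : V →ₗ[ℂ] V :=
  ∑ᶠ g, x g • ρ g

omit [Finite G] in
theorem Representation.sumSMul_apply [Fintype G] {V : Type*} [AddCommGroup V] [Module ℂ V]
    (ρ : Representation ℂ G V) (x : G → ℂ) (v : V) :
    ρ.sumSMul x v = ∑ g, x g • ρ g v := by
  rw [sumSMul, finsum_eq_sum_of_fintype, LinearMap.sum_apply]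
  rfl

theorem Representation.sumSMul_transport {V W : Type*} [AddCommGroup V] [Module ℂ V]
    [AddCommGroup W] [Module ℂ W] (ρ : Representation ℂ G V) (e : V ≃ₗ[ℂ] W) (x : G → ℂ) :
    (ρ.transport e).sumSMul x = e.conj (ρ.sumSMul x) := by
  have : Fintype G := Fintype.ofFinite G
  ext w
  simp [sumSMul_apply, transport_apply, LinearEquiv.conj_apply]

theorem Representation.toRepresentation_sumSMul {V : Type*} [AddCommGroup V] [Module ℂ V]
    {ρ : Representation ℂ G V} (W : Subrepresentation ρ) (x : G → ℂ) (w : W.toSubmodule) :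
    (W.toRepresentation.sumSMul x w : V) = ρ.sumSMul x w := by
  have : Fintype G := Fintype.ofFinite G
  simp only [sumSMul_apply, AddSubmonoidClass.coe_finsetSum, Submodule.coe_smul]
  rfl

/-- Maschke's theorem with induction on dimension: a reducible space splits into two proper stable
subspaces, and the element kills both. -/
theorem Representation.sumSMul_eq_zero_of_forall_irreducible (x : G → ℂ)
    (hx : ∀ (n : ℕ) (ρ : Representation ℂ G (Fin n → ℂ)), ρ.IsIrreducible → ρ.sumSMul x = 0)
    (n : ℕ) : ∀ {V : Type u} [AddCommGroup V] [Module ℂ V] [FiniteDimensional ℂ V]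
      (ρ : Representation ℂ G V), finrank ℂ V = n → ρ.sumSMul x = 0 := by
  induction n using Nat.strong_induction_on with
  | _ n ih =>
    intro V _ _ _ ρ hn
    by_cases hρ : ρ.IsIrreducible
    · have h := hx _ _ (hρ.transport (finBasis ℂ V).equivFun)
      rw [sumSMul_transport] at h
      simpa using h
    rw [isIrreducible_iff_forall_stable] at hρ
    by_cases hV : Nontrivial V
    · have : ∃ W : Submodule ℂ V, (∀ g, ∀ v ∈ W, ρ g v ∈ W) ∧ W ≠ ⊥ ∧ W ≠ ⊤ := by
        by_contra! h
        refine hρ ⟨hV, fun W hW => ?_⟩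
        by_contra! h'
        exact h'.2 (h W hW h'.1)
      obtain ⟨W, hW, hbot, htop⟩ := this
      obtain ⟨U, hU⟩ := exists_isCompl (⟨W, fun g v hv => hW g v hv⟩ : Subrepresentation ρ)
      have hU1 : IsCompl W U.toSubmodule := by
        constructor
        · rw [disjoint_iff]
          exact congrArg Subrepresentation.toSubmodule hU.inf_eq_bot
        · rw [codisjoint_iff]
          exact congrArg Subrepresentation.toSubmodule hU.sup_eq_top
      have hsub : ∀ W : Subrepresentation ρ, W.toSubmodule ≠ ⊤ →
          ∀ w ∈ W.toSubmodule, ρ.sumSMul x w = 0 := by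
        intro W hW w hw
        have := ih _ (hn ▸ Submodule.finrank_lt hW) W.toRepresentation rfl
        have h2 := toRepresentation_sumSMul W x ⟨w, hw⟩
        rw [this] at h2
        exact h2.symm
      have hUtop : U.toSubmodule ≠ ⊤ := by
        intro h
        rw [h] at hU1
        exact hbot (eq_bot_of_isCompl_top hU1)
      ext v
      have hv : v ∈ W ⊔ U.toSubmodule := by rw [hU1.sup_eq_top]; trivial
      obtain ⟨a, ha, b, hb, rfl⟩ := Submodule.mem_sup.1 hv
      rw [map_add, hsub ⟨W, fun g v hv => hW g v hv⟩ htop a ha, hsub U hUtop b hb]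
      simp
    · rw [not_nontrivial_iff_subsingleton] at hV
      exact Subsingleton.elim _ _

/-- The regular representation on functions. -/
def Representation.regular (G : Type*) [Group G] : Representation ℂ G (G → ℂ) where
  toFun g := LinearMap.funLeft ℂ ℂ (g⁻¹ * ·)
  map_one' := by ext; simp [LinearMap.funLeft]
  map_mul' x y := by ext; simp [LinearMap.funLeft, mul_assoc]

/-- An element of the complex group algebra that is killed by every irreducible representation
vanishes. -/
theorem Representation.eq_zero_of_forall_irreducible (x : G → ℂ)
    (hx : ∀ (n : ℕ) (ρ : Representation ℂ G (Fin n → ℂ)), ρ.IsIrreducible → ρ.sumSMul x = 0) :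
    x = 0 := by
  classical
  have : Fintype G := Fintype.ofFinite G
  have h := sumSMul_eq_zero_of_forall_irreducible x hx _ (regular G) rfl
  -- Acting on the delta function at `1` returns the coefficient function `x` itself.
  have h1 := LinearMap.congr_fun h (Pi.single 1 1)
  rw [sumSMul_apply] at h1
  funext g
  have h2 := congrFun h1 g
  simp only [Finset.sum_apply, Pi.smul_apply, LinearMap.zero_apply, Pi.zero_apply] at h2
  rw [Finset.sum_eq_single g] at h2
  · simpa [regular, LinearMap.funLeft] using h2
  · intro b _ hb
    have : b⁻¹ * g ≠ 1 := by
      rw [ne_eq, inv_mul_eq_one]; exact hb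
    simp [regular, LinearMap.funLeft, this]
  · simp

/-- A formal combination of group elements acting as zero on every irreducible representation
has vanishing coefficients. -/
theorem Representation.sum_ite_eq_zero_of_forall_irreducible {ι : Type*} [Fintype ι] [DecidableEq G]
    (f : ι → G) (c : ι → ℂ)
    (h : ∀ (n : ℕ) (ρ : Representation ℂ G (Fin n → ℂ)), ρ.IsIrreducible →
      ∀ v, ∑ i, c i • ρ (f i) v = 0) (g : G) : ∑ i, (if f i = g then c i else 0) = 0 := by
  have : Fintype G := Fintype.ofFinite G
  refine congrFun (eq_zero_of_forall_irreducible (fun g => ∑ i, (if f i = g then c i else 0))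
    fun n ρ hρ => ?_) g
  refine LinearMap.ext fun v => ?_
  rw [sumSMul_apply, LinearMap.zero_apply, ← h n ρ hρ v]
  simp only [Finset.sum_smul]
  rw [Finset.sum_comm]
  refine Finset.sum_congr rfl fun i _ => ?_
  rw [Finset.sum_eq_single (f i)]
  · simp
  · intro b _ hb
    simp [hb.symm]
  · simp

end Representations

/-! ### Schur's lemma, linear twists, and the invariant-counting form of `GC*` -/

section Characters

open Representation Module
open scoped commutatorElement

variable {G : Type*} [Group G]

/-- The product of a representation with a linear character. -/
def Representation.twist {V : Type*} [AddCommGroup V] [Module ℂ V] (ρ : Representation ℂ G V)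
    (μ : G →* ℂˣ) : Representation ℂ G V where
  toFun g := (μ g : ℂ) • ρ g
  map_one' := by simp
  map_mul' x y := by
    ext v
    rw [map_mul, map_mul, Units.val_mul, LinearMap.smul_apply, Module.End.mul_apply,
      Module.End.mul_apply, LinearMap.smul_apply, LinearMap.smul_apply, map_smul, mul_smul]

theorem Representation.twist_apply {V : Type*} [AddCommGroup V] [Module ℂ V]
    (ρ : Representation ℂ G V) (μ : G →* ℂˣ) (g : G) (v : V) :
    ρ.twist μ g v = (μ g : ℂ) • ρ g v := rfl

theorem Representation.character_twist {V : Type*} [AddCommGroup V] [Module ℂ V]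
    (ρ : Representation ℂ G V) (μ : G →* ℂˣ) (g : G) :
    (ρ.twist μ).character g = μ g * ρ.character g := by
  simp [character, twist]

theorem Representation.IsIrreducible.twist {V : Type*} [AddCommGroup V] [Module ℂ V]
    {ρ : Representation ℂ G V} (h : ρ.IsIrreducible) (μ : G →* ℂˣ) : (ρ.twist μ).IsIrreducible := by
  rw [isIrreducible_iff_forall_stable] at h ⊢
  refine ⟨h.1, fun W hW => h.2 W fun g v hv => ?_⟩
  have := W.smul_mem (μ g : ℂ)⁻¹ (hW g v hv)
  rwa [twist_apply, inv_smul_smul₀ (μ g).ne_zero] at this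

/-- Schur's lemma: an eigenspace of `T` is stable and nonzero, hence everything. -/
theorem Representation.IsIrreducible.exists_eq_smul {V : Type*} [AddCommGroup V] [Module ℂ V]
    [FiniteDimensional ℂ V] {ρ : Representation ℂ G V} (h : ρ.IsIrreducible) (T : V →ₗ[ℂ] V)
    (hT : ∀ g v, T (ρ g v) = ρ g (T v)) : ∃ c : ℂ, ∀ v, T v = c • v := by
  rw [isIrreducible_iff_forall_stable] at h
  have := h.1
  obtain ⟨c, hc⟩ := Module.End.exists_eigenvalue T
  refine ⟨c, ?_⟩
  have hst : ∀ g, ∀ v ∈ Module.End.eigenspace T c, ρ g v ∈ Module.End.eigenspace T c := by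
    intro g v hv
    rw [Module.End.mem_eigenspace_iff] at hv ⊢
    rw [hT, hv, map_smul]
  rcases h.2 _ hst with h | h
  · exact absurd h hc
  · intro v
    exact Module.End.mem_eigenspace_iff.1 (h ▸ Submodule.mem_top)

/-- By Schur's lemma every group element acts as a scalar, so every line is stable. -/
theorem Representation.IsIrreducible.finrank_eq_one_of_commute {V : Type*} [AddCommGroup V]
    [Module ℂ V] [FiniteDimensional ℂ V] {ρ : Representation ℂ G V} (h : ρ.IsIrreducible)
    (hc : ∀ g k v, ρ g (ρ k v) = ρ k (ρ g v)) : finrank ℂ V = 1 := by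
  have h' := h
  rw [isIrreducible_iff_forall_stable] at h'
  have := h'.1
  obtain ⟨v, hv⟩ := exists_ne (0 : V)
  have hst : ∀ g, ∀ w ∈ ℂ ∙ v, ρ g w ∈ ℂ ∙ v := by
    intro g w hw
    obtain ⟨c, hc⟩ := h.exists_eq_smul (ρ g) fun k v => hc g k v
    rw [hc]
    exact Submodule.smul_mem _ _ hw
  rcases h'.2 _ hst with h0 | h0
  · exact absurd (Submodule.span_singleton_eq_bot.1 h0) hv
  · rw [← finrank_top, ← h0, finrank_span_singleton hv]

theorem Representation.IsIrreducible.finrank_eq_one_of_commutator {V : Type*} [AddCommGroup V]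
    [Module ℂ V] [FiniteDimensional ℂ V] {ρ : Representation ℂ G V} (h : ρ.IsIrreducible)
    (hc : ∀ k ∈ commutator G, ∀ v, ρ k v = v) : finrank ℂ V = 1 := by
  refine h.finrank_eq_one_of_commute fun g k v => ?_
  have h1 : g * k = k * g * ⁅g⁻¹, k⁻¹⁆ := by simp [commutatorElement_def, mul_assoc]
  rw [← Module.End.mul_apply, ← map_mul, h1, map_mul, Module.End.mul_apply,
    hc _ (Subgroup.commutator_mem_commutator (Subgroup.mem_top _) (Subgroup.mem_top _)), map_mul, Module.End.mul_apply]

theorem Representation.apply_of_finrank_eq_one {V : Type*} [AddCommGroup V]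
    [Module ℂ V] {ρ : Representation ℂ G V} (h : finrank ℂ V = 1) :
    ∃ μ : G →* ℂˣ, ∀ g v, ρ g v = (μ g : ℂ) • v := by
  have h0 : ∀ g, ∃ c : ℂ, ∀ v, ρ g v = c • v := by
    intro g
    obtain ⟨v, hv, h1⟩ := finrank_eq_one_iff'.1 h
    obtain ⟨c, hc⟩ := h1 (ρ g v)
    refine ⟨c, fun w => ?_⟩
    obtain ⟨d, rfl⟩ := h1 w
    rw [map_smul, ← hc, smul_comm]
  choose c hc using h0
  obtain ⟨v, hv, -⟩ := finrank_eq_one_iff'.1 h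
  have hinj : ∀ a b : ℂ, a • v = b • v → a = b := fun a b hab => smul_left_injective ℂ hv hab
  refine ⟨MonoidHom.toHomUnits ⟨⟨c, ?_⟩, ?_⟩, fun g w => ?_⟩
  · apply hinj
    rw [← hc]
    simp
  · intro x y
    apply hinj
    change c (x * y) • v = (c x * c y) • v
    rw [← hc, map_mul, Module.End.mul_apply, hc, hc, mul_comm, mul_smul, smul_comm]
  · exact hc g w

theorem MonoidHom.eq_one_of_mem_commutator {A : Type*} [CommGroup A] (μ : G →* A) {k : G}
    (hk : k ∈ commutator G) : μ k = 1 :=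
  Abelianization.commutator_subset_ker μ hk

/-- Inflation preserves irreducibility and degree, and a multiple of `|G|` is a multiple of `|G/N|`.
-/
theorem IsGCStar.quotient (hG : IsGCStar G) (N : Subgroup G) [N.Normal] : IsGCStar (G ⧸ N) := by
  intro χ ψ hχ hψ h1 h2 h3
  have key : ∀ χ : G ⧸ N → ℂ, IsIrrChar (G ⧸ N) χ → IsIrrChar G (χ ∘ QuotientGroup.mk' N) := by
    rintro χ ⟨n, ρ, hρ, rfl⟩
    refine ⟨n, ρ.comp (QuotientGroup.mk' N), ?_, rfl⟩
    rw [isIrreducible_iff_forall_stable] at hρ ⊢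
    refine ⟨hρ.1, fun W hW => hρ.2 W fun g => ?_⟩
    induction g using QuotientGroup.induction_on with
    | H g => exact hW g
  obtain ⟨n, hn, hd, α, hα⟩ := hG _ _ (key χ hχ) (key ψ hψ) (by simpa using h1) (by simpa using h2)
    (by simpa using h3)
  refine ⟨n, hn, (Subgroup.card_quotient_dvd_card N).trans hd, α, fun g => ?_⟩
  induction g using QuotientGroup.induction_on with
  | H g => exact hα g

theorem IsGCStar.of_mulEquiv {H : Type*} [Group H] (hG : IsGCStar G) (e : G ≃* H) :
    IsGCStar H := by
  intro χ ψ hχ hψ h1 h2 h3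
  have key : ∀ χ : H → ℂ, IsIrrChar H χ → IsIrrChar G (χ ∘ e) := by
    rintro χ ⟨n, ρ, hρ, rfl⟩
    refine ⟨n, ρ.comp e.toMonoidHom, ?_, rfl⟩
    rw [isIrreducible_iff_forall_stable] at hρ ⊢
    refine ⟨hρ.1, fun W hW => hρ.2 W fun g => ?_⟩
    obtain ⟨g, rfl⟩ := e.surjective g
    exact hW g
  obtain ⟨n, hn, hd, α, hα⟩ := hG _ _ (key χ hχ) (key ψ hψ) (by simpa using h1) (by simpa using h2)
    (by simpa using h3)
  refine ⟨n, hn, (Nat.card_congr e.toEquiv) ▸ hd, α, fun g => ?_⟩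
  obtain ⟨g, rfl⟩ := e.surjective g
  exact hα g

variable [Finite G]

theorem Representation.sum_character_eq {V : Type*} [AddCommGroup V] [Module ℂ V]
    [FiniteDimensional ℂ V] (ρ : Representation ℂ G V) (H : Subgroup G) [Fintype H] :
    ∑ h : H, ρ.character h = ((Nat.card H * finrank ℂ (invariants (ρ.comp H.subtype)) : ℕ) : ℂ) := by
  have h0 : (Nat.card H : ℂ) ≠ 0 := by
    exact_mod_cast Nat.card_pos.ne'
  have : Invertible (Nat.card H : ℂ) := invertibleOfNonzero h0
  have h1 := card_inv_mul_sum_char_eq_finrank (ρ.comp H.subtype : Representation ℂ H V)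
  push_cast
  rw [← h1, mul_inv_cancel_left₀ h0]
  rfl

/-- The character sum over `H` is a natural number, so the field automorphism carrying one character
to the other leaves it unchanged. -/
theorem IsGCStar.finrank_invariants_eq (hG : IsGCStar G) {V W : Type*} [AddCommGroup V]
    [Module ℂ V] [FiniteDimensional ℂ V] [AddCommGroup W] [Module ℂ W] [FiniteDimensional ℂ W]
    {ρ : Representation ℂ G V} {σ : Representation ℂ G W} (hρ : ρ.IsIrreducible)
    (hσ : σ.IsIrreducible) (h1 : finrank ℂ V ≠ 1) (h2 : finrank ℂ V = finrank ℂ W)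
    (H : Subgroup G) : finrank ℂ (invariants (ρ.comp H.subtype)) =
      finrank ℂ (invariants (σ.comp H.subtype)) := by
  have : Fintype H := Fintype.ofFinite H
  obtain ⟨n, -, -, α, hα⟩ := hG ρ.character σ.character hρ.isIrrChar hσ.isIrrChar
    (by rw [char_one]; exact_mod_cast h1) (by rw [char_one, ← h2]; exact_mod_cast h1)
    (by rw [char_one, char_one, h2])
  choose z hz1 hz2 using hα
  have e1 := ρ.sum_character_eq H
  have e2 := σ.sum_character_eq H
  have e3 : ∑ h : H, z h =
      ((Nat.card H * finrank ℂ (invariants (ρ.comp H.subtype)) : ℕ) : cyclotomicSubfield n) := by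
    apply Subtype.ext
    simpa [hz1] using e1
  have e4 := congrArg (fun w => ((α w : cyclotomicSubfield n) : ℂ)) e3
  simp only [map_sum, map_natCast] at e4
  have e5 : ((∑ x : H, α (z x) : cyclotomicSubfield n) : ℂ) = ∑ h : H, σ.character h := by
    simp [hz2]
  rw [e5, e2] at e4
  have e6 := Nat.cast_injective (R := ℂ) e4
  exact (Nat.eq_of_mul_eq_mul_left Nat.card_pos e6).symm

theorem IsGCStar.sum_character_eq (hG : IsGCStar G) {V W : Type*} [AddCommGroup V]
    [Module ℂ V] [FiniteDimensional ℂ V] [AddCommGroup W] [Module ℂ W] [FiniteDimensional ℂ W]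
    {ρ : Representation ℂ G V} {σ : Representation ℂ G W} (hρ : ρ.IsIrreducible)
    (hσ : σ.IsIrreducible) (h1 : finrank ℂ V ≠ 1) (h2 : finrank ℂ V = finrank ℂ W)
    (H : Subgroup G) [Fintype H] : ∑ h : H, ρ.character h = ∑ h : H, σ.character h := by
  rw [ρ.sum_character_eq, σ.sum_character_eq, hG.finrank_invariants_eq hρ hσ h1 h2]

end Characters

/-! ### Producing irreducible representations with prescribed behaviour -/

section Existence

open Representation Module
open scoped commutatorElement

variable {G : Type*} [Group G]

theorem Representation.IsIrreducible.comp_surjective {H V : Type*} [Group H] [AddCommGroup V]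
    [Module ℂ V] {ρ : Representation ℂ H V} (hρ : ρ.IsIrreducible) (f : G →* H)
    (hf : Function.Surjective f) :
    IsIrreducible (ρ.comp f : Representation ℂ G V) := by
  rw [isIrreducible_iff_forall_stable] at hρ ⊢
  refine ⟨hρ.1, fun W hW => hρ.2 W fun g => ?_⟩
  obtain ⟨g, rfl⟩ := hf g
  exact hW g

variable [Finite G]

theorem Representation.exists_irreducible_sum_ne_zero {ι : Type*} [Fintype ι] [DecidableEq G]
    (f : ι → G) (c : ι → ℂ) (g : G) (h : ∑ i, (if f i = g then c i else 0) ≠ 0) :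
    ∃ (n : ℕ) (ρ : Representation ℂ G (Fin n → ℂ)), ρ.IsIrreducible ∧
      ∃ v, ∑ i, c i • ρ (f i) v ≠ 0 := by
  by_contra! h'
  exact h (sum_ite_eq_zero_of_forall_irreducible f c h' g)

theorem Representation.exists_irreducible_ne_one {g : G} (hg : g ≠ 1) :
    ∃ (n : ℕ) (ρ : Representation ℂ G (Fin n → ℂ)), ρ.IsIrreducible ∧ ρ g ≠ 1 := by
  classical
  obtain ⟨n, ρ, hρ, v, hv⟩ := exists_irreducible_sum_ne_zero ![g, 1] ![1, -1] g
    (by simp [hg.symm])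
  refine ⟨n, ρ, hρ, fun h => hv ?_⟩
  simp [h]

/-- A normal subgroup not containing the commutator subgroup is in the kernel of some
irreducible representation of degree greater than one. -/
theorem Representation.exists_irreducible_nonlinear_of_normal (S : Subgroup G) [S.Normal]
    (hS : ¬ commutator G ≤ S) :
    ∃ (n : ℕ) (ρ : Representation ℂ G (Fin n → ℂ)), ρ.IsIrreducible ∧
      finrank ℂ (Fin n → ℂ) ≠ 1 ∧ ∀ s ∈ S, ρ s = 1 := by
  obtain ⟨g, hg, hgS⟩ := SetLike.not_le_iff_exists.1 hS
  have hg1 : (QuotientGroup.mk' S g) ≠ 1 := by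
    simpa using hgS
  obtain ⟨n, ρ, hρ, h⟩ := exists_irreducible_ne_one hg1
  refine ⟨n, ρ.comp (QuotientGroup.mk' S),
    hρ.comp_surjective _ (QuotientGroup.mk'_surjective S), fun h1 => h ?_, fun s hs => ?_⟩
  · obtain ⟨μ, hμ⟩ := apply_of_finrank_eq_one (ρ := ρ) h1
    refine LinearMap.ext fun w => ?_
    rw [hμ, ← MonoidHom.comp_apply,
      MonoidHom.eq_one_of_mem_commutator (μ.comp (QuotientGroup.mk' S)) hg]
    simp
  · have : QuotientGroup.mk' S s = 1 := by simpa using hs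
    rw [MonoidHom.comp_apply, this, map_one]

/-- For a group in `GC*`, every normal subgroup is comparable to the commutator subgroup. -/
theorem IsGCStar.le_commutator_of_not_commutator_le (hG : IsGCStar G) (S : Subgroup G) [S.Normal]
    (hS : ¬ commutator G ≤ S) : S ≤ commutator G := by
  obtain ⟨n, ρ, hρ, hn, hker⟩ := exists_irreducible_nonlinear_of_normal S hS
  intro s hs
  by_contra hsG
  have h1 : Abelianization.of s ≠ 1 := by
    intro h
    exact hsG ((QuotientGroup.eq_one_iff s).1 h)
  obtain ⟨φ, hφ⟩ := CommGroup.exists_apply_ne_one_of_hasEnoughRootsOfUnity (Abelianization G) ℂ h1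
  -- `S` acts trivially through `ρ`, hence also through the twist; but there `s` acts as the scalar
  -- `φ(s) ≠ 1`.
  have h2 := hG.finrank_invariants_eq hρ (hρ.twist (φ.comp Abelianization.of)) hn rfl S
  have e1 : invariants (ρ.comp S.subtype : Representation ℂ S (Fin n → ℂ)) = ⊤ := by
    rw [eq_top_iff]
    intro v _ t
    rw [MonoidHom.comp_apply, S.coe_subtype, hker t t.2]
    rfl
  have e2 : invariants ((ρ.twist (φ.comp Abelianization.of)).comp S.subtype :
      Representation ℂ S (Fin n → ℂ)) = ⊤ := by
    apply Submodule.eq_top_of_finrank_eq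
    rw [← h2, e1, finrank_top]
  have := ((isIrreducible_iff_forall_stable ρ).1 hρ).1
  obtain ⟨v, hv⟩ := exists_ne (0 : Fin n → ℂ)
  have h3 : v ∈ invariants ((ρ.twist (φ.comp Abelianization.of)).comp S.subtype :
      Representation ℂ S (Fin n → ℂ)) := by rw [e2]; trivial
  have h4 := h3 ⟨s, hs⟩
  rw [MonoidHom.comp_apply, S.coe_subtype, twist_apply, hker s hs, Module.End.one_apply] at h4
  have h5 := smul_left_injective ℂ hv (h4.trans (one_smul ℂ v).symm)
  exact hφ (Units.ext h5)

end Existence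

/-! ### Elements whose conjugacy class is a full coset of the commutator subgroup -/

section VanishingOffCommutator

open Representation Module
open scoped commutatorElement

variable {G : Type*} [Group G] [Finite G]

instance : Finite (Abelianization G →* ℂˣ) := by
  have e := (CommGroup.monoidHom_mulEquiv_of_hasEnoughRootsOfUnity (Abelianization G) ℂ).some
  exact Finite.of_equiv _ e.symm.toEquiv

theorem sum_linearCharacter_eq_zero [Fintype (Abelianization G →* ℂˣ)] {g : G}
    (hg : g ∉ commutator G) :
    ∑ μ : Abelianization G →* ℂˣ, (μ (Abelianization.of g) : ℂ) = 0 := by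
  have h1 : Abelianization.of g ≠ 1 := fun h => hg ((QuotientGroup.eq_one_iff g).1 h)
  obtain ⟨φ, hφ⟩ := CommGroup.exists_apply_ne_one_of_hasEnoughRootsOfUnity (Abelianization G) ℂ h1
  have h2 : (φ (Abelianization.of g) : ℂ) * ∑ μ : Abelianization G →* ℂˣ,
      (μ (Abelianization.of g) : ℂ) = ∑ μ : Abelianization G →* ℂˣ,
      (μ (Abelianization.of g) : ℂ) := by
    rw [Finset.mul_sum]
    exact Fintype.sum_equiv (Equiv.mulLeft φ) _ _ fun μ => by simp
  have h3 : ((φ (Abelianization.of g) : ℂ) - 1) * ∑ μ : Abelianization G →* ℂˣ,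
      (μ (Abelianization.of g) : ℂ) = 0 := by rw [sub_mul, h2, one_mul, sub_self]
  rcases mul_eq_zero.1 h3 with h | h
  · exact absurd (Units.ext (sub_eq_zero.1 h)) hφ
  · exact h

/-- If the elements of `L ∩ tG'` are all conjugate to `t ∈ L \ G'`, then every nonlinear
irreducible character of the `GC*`-group `G` vanishes on `t`. -/
theorem IsGCStar.character_eq_zero (hG : IsGCStar G) (L : Subgroup G) {t : G}
    (ht : t ∉ commutator G) (htL : t ∈ L)
    (hconj : ∀ h ∈ L, t⁻¹ * h ∈ commutator G → IsConj t h)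
    {V : Type*} [AddCommGroup V] [Module ℂ V] [FiniteDimensional ℂ V]
    {ρ : Representation ℂ G V} (hρ : ρ.IsIrreducible) (h1 : finrank ℂ V ≠ 1) :
    ρ.character t = 0 := by
  classical
  have : Fintype L := Fintype.ofFinite L
  have : Fintype (Abelianization G →* ℂˣ) := Fintype.ofFinite _
  -- A linear twist has the same degree, hence the same sum over `L`.
  have e1 : ∀ μ : Abelianization G →* ℂˣ,
      ∑ h : L, (μ (Abelianization.of (h : G)) : ℂ) * ρ.character h = ∑ h : L, ρ.character h := by
    intro μ
    rw [hG.sum_character_eq hρ (hρ.twist (μ.comp Abelianization.of)) h1 rfl L]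
    simp [character_twist]
  -- Fourier inversion on `G/G'`: weighting by `μ(t⁻¹)` and summing over `μ` isolates the part of
  -- the sum over `L ∩ tG'`, where the character is constantly its value at `t`.
  have e2 : ∑ μ : Abelianization G →* ℂˣ, (μ (Abelianization.of t⁻¹) : ℂ) *
      ∑ h : L, (μ (Abelianization.of (h : G)) : ℂ) * ρ.character h = 0 := by
    simp_rw [e1]
    rw [← Finset.sum_mul, sum_linearCharacter_eq_zero (by rwa [inv_mem_iff]), zero_mul]
  have e3 : ∑ h : L, (∑ μ : Abelianization G →* ℂˣ, (μ (Abelianization.of (t⁻¹ * h)) : ℂ)) *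
      ρ.character h = 0 := by
    rw [← e2]
    simp_rw [Finset.mul_sum, Finset.sum_mul]
    rw [Finset.sum_comm]
    refine Finset.sum_congr rfl fun μ _ => Finset.sum_congr rfl fun h _ => ?_
    rw [map_mul, map_mul, Units.val_mul, mul_assoc]
  have e4 : ∀ h : L, (∑ μ : Abelianization G →* ℂˣ, (μ (Abelianization.of (t⁻¹ * h)) : ℂ)) *
      ρ.character h = if t⁻¹ * (h : G) ∈ commutator G then
        Fintype.card (Abelianization G →* ℂˣ) * ρ.character t else 0 := by
    intro h
    split_ifs with hh
    · have : Abelianization.of (t⁻¹ * (h : G)) = 1 := (QuotientGroup.eq_one_iff _).2 hh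
      obtain ⟨g, hg⟩ := isConj_iff.1 (hconj h h.2 hh)
      rw [this, ← hg, char_conj]
      simp
    · rw [sum_linearCharacter_eq_zero hh, zero_mul]
  simp_rw [e4] at e3
  rw [← Finset.sum_filter, Finset.sum_const, nsmul_eq_mul, ← mul_assoc] at e3
  rcases mul_eq_zero.1 e3 with h | h
  · exfalso
    rcases mul_eq_zero.1 h with h | h
    · rw [Nat.cast_eq_zero, Finset.card_eq_zero] at h
      have : (⟨t, htL⟩ : L) ∈ ({x | t⁻¹ * (x : G) ∈ commutator G} : Finset L) := by
        simp [one_mem]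
      rw [h] at this
      simp at this
    · exact Fintype.card_ne_zero (Nat.cast_eq_zero.1 h)
  · exact h

/-- If every nonlinear irreducible character vanishes at `t`, then the conjugacy class of `t`
is the coset `tG'`. -/
theorem isConj_mul_of_forall_character_eq_zero {t : G}
    (ht : ∀ (n : ℕ) (ρ : Representation ℂ G (Fin n → ℂ)), ρ.IsIrreducible →
      finrank ℂ (Fin n → ℂ) ≠ 1 → ρ.character t = 0) {k : G} (hk : k ∈ commutator G) :
    IsConj t (t * k) := by
  classical
  have : Fintype G := Fintype.ofFinite G
  have : Fintype (commutator G) := Fintype.ofFinite _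
  -- The group-algebra element `|G'| ∑ y t y⁻¹ - |G| ∑ t c`, with `y` in `G` and `c` in `G'`, will
  -- be killed by all irreducible representations. If `tk` were not conjugate to `t`, its
  -- coefficient would be `-|G|`, not zero.
  let f : G ⊕ commutator G → G := Sum.elim (fun y => y * t * y⁻¹) (fun c => t * c)
  let c : G ⊕ commutator G → ℂ := Sum.elim (fun _ => Fintype.card (commutator G))
    (fun _ => -Fintype.card G)
  have key := sum_ite_eq_zero_of_forall_irreducible f c (fun n ρ hρ v => ?_) (t * k)
  · by_contra hcon
    simp only [Fintype.sum_sum_type, f, c, Sum.elim_inl, Sum.elim_inr] at key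
    rw [Finset.sum_eq_zero, zero_add, Finset.sum_eq_single ⟨k, hk⟩] at key
    · simp at key
    · intro b _ hb
      exact if_neg fun h => hb (Subtype.ext (mul_left_cancel h))
    · simp
    · intro y _
      exact if_neg fun h => hcon (isConj_iff.2 ⟨y, h⟩)
  · simp only [Fintype.sum_sum_type, f, c, Sum.elim_inl, Sum.elim_inr]
    by_cases h1 : finrank ℂ (Fin n → ℂ) = 1
    · obtain ⟨μ, hμ⟩ := apply_of_finrank_eq_one (ρ := ρ) h1
      have h2 : ∀ y, μ (y * t * y⁻¹) = μ t := fun y => by simp [mul_comm]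
      have h3 : ∀ c : commutator G, μ (t * c) = μ t := fun c => by
        rw [map_mul, MonoidHom.eq_one_of_mem_commutator μ c.2, mul_one]
      simp only [hμ, h2, h3, Finset.sum_const, Finset.card_univ]
      module
    -- In a nonlinear representation both sums vanish separately: the class sum is a scalar of trace
    -- zero, and the sum over `G'` lands in the `G'`-invariants, which form a proper stable
    -- subspace.
    · have h2 : ∀ v, ∑ y : G, ρ (y * t * y⁻¹) v = 0 := by
        let T : (Fin n → ℂ) →ₗ[ℂ] (Fin n → ℂ) := ∑ y : G, ρ (y * t * y⁻¹)
        have hT : ∀ v, T v = ∑ y : G, ρ (y * t * y⁻¹) v := fun v => by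
          rw [LinearMap.sum_apply]
        obtain ⟨a, ha⟩ := hρ.exists_eq_smul T fun g v => by
          rw [hT, hT, map_sum]
          refine Fintype.sum_equiv (Equiv.mulLeft g⁻¹) _ _ fun y => ?_
          rw [← Module.End.mul_apply, ← Module.End.mul_apply, ← map_mul, ← map_mul]
          congr 2
          simp [mul_assoc]
        have htr : LinearMap.trace ℂ _ T = 0 := by
          rw [map_sum]
          refine Finset.sum_eq_zero fun y _ => ?_
          exact (ρ.char_conj t y).trans (ht n ρ hρ h1)
        have hTa : T = a • LinearMap.id := LinearMap.ext ha
        rw [hTa, map_smul, LinearMap.trace_id, smul_eq_mul] at htr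
        intro v
        rw [← hT, ha]
        rcases mul_eq_zero.1 htr with h | h
        · rw [h, zero_smul]
        · have h0 : finrank ℂ (Fin n → ℂ) = 0 := by exact_mod_cast h
          have := finrank_zero_iff.1 h0
          exact Subsingleton.elim _ _
      have h3 : ∀ v, ∑ c : commutator G, ρ (t * c) v = 0 := by
        intro v
        let W := invariants (ρ.comp (commutator G).subtype : Representation ℂ _ (Fin n → ℂ))
        have hW : W = ⊥ := by
          refine (((isIrreducible_iff_forall_stable ρ).1 hρ).2 W
            (fun g w hw c => ?_)).resolve_right fun h => h1 ?_
          · have h5 := hw ⟨g⁻¹ * c * g, by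
              simpa using (inferInstance : (commutator G).Normal).conj_mem c c.2 g⁻¹⟩
            change ρ c (ρ g w) = ρ g w
            change ρ (g⁻¹ * c * g) w = w at h5
            conv_rhs => rw [← h5]
            rw [← Module.End.mul_apply, ← Module.End.mul_apply, ← map_mul, ← map_mul]
            simp [mul_assoc]
          · refine hρ.finrank_eq_one_of_commutator fun k hk v => ?_
            have : v ∈ W := h ▸ Submodule.mem_top
            exact this ⟨k, hk⟩
        have h4 : ∑ c : commutator G, ρ c v ∈ W := by
          intro d
          rw [map_sum]
          refine Fintype.sum_equiv (Equiv.mulLeft d) _ _ fun y => ?_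
          rw [MonoidHom.comp_apply, ← Module.End.mul_apply, ← map_mul]
          rfl
        rw [hW, Submodule.mem_bot] at h4
        simp_rw [map_mul, Module.End.mul_apply]
        rw [← map_sum, h4, map_zero]
      rw [← Finset.smul_sum, h2, ← Finset.smul_sum, h3]
      simp

/-- If the elements of `L ∩ tG'` are all conjugate to `t ∈ L \ G'`, then the conjugacy class of
`t` in the `GC*`-group `G` is the coset `tG'`. -/
theorem IsGCStar.isConj_mul (hG : IsGCStar G) (L : Subgroup G) {t : G}
    (ht : t ∉ commutator G) (htL : t ∈ L)
    (hconj : ∀ h ∈ L, t⁻¹ * h ∈ commutator G → IsConj t h) {k : G} (hk : k ∈ commutator G) :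
    IsConj t (t * k) :=
  isConj_mul_of_forall_character_eq_zero
    (fun _ _ hρ h1 => hG.character_eq_zero L ht htL hconj hρ h1) hk

end VanishingOffCommutator

/-! ### Clifford theory for linear characters of a complemented normal subgroup -/

section SemidirectStabilizer

open Representation Module

variable {G : Type*} [Group G]

/-- Vectors on which a group acts through distinct linear characters are linearly independent. -/
theorem Representation.linearIndependent_of_injective_weights {N V ι : Type*} [Group N]
    [AddCommGroup V] [Module ℂ V] (ρ : Representation ℂ N V) (w : ι → V) (hw : ∀ i, w i ≠ 0)
    (μ : ι → N →* ℂˣ) (hμ : Function.Injective μ) (h : ∀ i n, ρ n (w i) = (μ i n : ℂ) • w i) :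
    LinearIndependent ℂ w := by
  rw [linearIndependent_iff']
  intro s c hc i hi
  have hinj : Function.Injective fun i => (Units.coeHom ℂ).comp (μ i) := by
    intro i j hij
    refine hμ (MonoidHom.ext fun n => Units.ext ?_)
    exact DFunLike.congr_fun hij n
  -- Dedekind's independence of characters, applied after pairing the relation with a functional
  -- that does not vanish on the chosen vector.
  have hind := (linearIndependent_monoidHom N ℂ).comp _ hinj
  rw [linearIndependent_iff'] at hind
  obtain ⟨φ, hφ⟩ : ∃ φ : Dual ℂ V, φ (w i) ≠ 0 := by
    by_contra! h'
    exact hw i ((forall_dual_apply_eq_zero_iff ℂ _).1 h')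
  have key := hind s (fun j => c j * φ (w j)) (by
    funext n
    have h1 := congrArg (fun v => φ (ρ n v)) hc
    simp only [map_sum, map_smul, h, map_zero, smul_eq_mul] at h1
    simp only [Finset.sum_apply, Pi.smul_apply, Function.comp_apply, MonoidHom.coe_comp,
      Units.coeHom_apply, smul_eq_mul, Pi.zero_apply]
    rw [← h1]
    exact Finset.sum_congr rfl fun j _ => by ring) i hi
  exact (mul_eq_zero.1 key).resolve_right hφ

/-- The stabilizer in `M` of a linear character of the normal subgroup `N`. -/
def linearCharacterStabilizer (N M : Subgroup G) [N.Normal] (θ : N →* ℂˣ) : Subgroup G where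
  carrier := {m | m ∈ M ∧ ∀ n, θ (MulAut.conjNormal m n) = θ n}
  one_mem' := ⟨one_mem _, fun n => by simp⟩
  mul_mem' := by
    rintro a b ⟨ha, ha'⟩ ⟨hb, hb'⟩
    refine ⟨mul_mem ha hb, fun n => ?_⟩
    rw [map_mul, MulAut.mul_apply, ha', hb']
  inv_mem' := by
    rintro a ⟨ha, ha'⟩
    refine ⟨inv_mem ha, fun n => ?_⟩
    rw [← ha', ← MulAut.mul_apply, ← map_mul]
    simp

section Induced

variable {V : Type*} [AddCommGroup V] [Module ℂ V] {ρ : Representation ℂ G V} {v : V}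
  {N M : Subgroup G} [N.Normal] {θ : N →* ℂˣ}

theorem Representation.apply_conj_weight (hN : ∀ n : N, ρ n v = (θ n : ℂ) • v) (m : G) (n : N) :
    ρ n (ρ m v) = (θ (MulAut.conjNormal m⁻¹ n) : ℂ) • ρ m v := by
  have h1 : (n : G) * m = m * (MulAut.conjNormal m⁻¹ n : N) := by
    simp [mul_assoc]
  rw [← Module.End.mul_apply, ← map_mul, h1, map_mul, Module.End.mul_apply, hN, map_smul]

/-- Since `G = NM` and `N` scales every `M`-translate of `v`, the span of these translates is
stable. -/
theorem Representation.IsIrreducible.span_eq_top (hρ : ρ.IsIrreducible) (hv : v ≠ 0)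
    (hNM : N.IsComplement' M) (hN : ∀ n : N, ρ n v = (θ n : ℂ) • v) :
    Submodule.span ℂ (Set.range fun m : M => ρ m v) = ⊤ := by
  have hst : ∀ g, ∀ w ∈ Submodule.span ℂ (Set.range fun m : M => ρ m v),
      ρ g w ∈ Submodule.span ℂ (Set.range fun m : M => ρ m v) := by
    intro g w hw
    induction hw using Submodule.span_induction with
    | zero => simp
    | add x y _ _ hx hy => rw [map_add]; exact add_mem hx hy
    | smul a x _ hx => rw [map_smul]; exact Submodule.smul_mem _ _ hx
    | mem x hx =>
      obtain ⟨m, rfl⟩ := hx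
      have hg : g ∈ N ⊔ M := by rw [hNM.sup_eq_top]; trivial
      obtain ⟨n, hn, k, hk, rfl⟩ := Subgroup.mem_sup_of_normal_left.1 hg
      rw [map_mul, Module.End.mul_apply, ← Module.End.mul_apply (ρ k), ← map_mul,
        apply_conj_weight hN (k * m) ⟨n, hn⟩]
      exact Submodule.smul_mem _ _ (Submodule.subset_span ⟨⟨k * m, mul_mem hk m.2⟩, rfl⟩)
  refine (((isIrreducible_iff_forall_stable ρ).1 hρ).2 _ hst).resolve_left fun h => hv ?_
  have : ρ (1 : M) v ∈ Submodule.span ℂ (Set.range fun m : M => ρ m v) :=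
    Submodule.subset_span ⟨1, rfl⟩
  rw [h, Submodule.mem_bot] at this
  simpa using this

/-- The conjugates under `M` of a linear character. -/
abbrev linearCharacterOrbit (N M : Subgroup G) [N.Normal] (θ : N →* ℂˣ) : Set (N →* ℂˣ) :=
  Set.range fun m : M => θ.comp (MulAut.conjNormal (m : G)⁻¹ : MulAut N).toMonoidHom

theorem inv_mul_mem_linearCharacterStabilizer {m k : M}
    (h : θ.comp (MulAut.conjNormal (m : G)⁻¹ : MulAut N).toMonoidHom =
      θ.comp (MulAut.conjNormal (k : G)⁻¹ : MulAut N).toMonoidHom) :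
    (m : G)⁻¹ * k ∈ linearCharacterStabilizer N M θ := by
  refine ⟨mul_mem (inv_mem m.2) k.2, fun n => ?_⟩
  have := DFunLike.congr_fun h (MulAut.conjNormal (k : G) n)
  simp only [MonoidHom.comp_apply, MulEquiv.toMonoidHom_eq_coe, MonoidHom.coe_coe,
    ← MulAut.mul_apply, ← map_mul] at this
  rw [this]
  simp

variable [Finite G] {ψ : linearCharacterStabilizer N M θ →* ℂˣ}

omit [Finite G] in
/-- A basis of translates of `v`, indexed by the conjugates of the linear character. -/
theorem Representation.IsIrreducible.exists_weight_family (hρ : ρ.IsIrreducible) (hv : v ≠ 0)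
    (hNM : N.IsComplement' M) (hN : ∀ n : N, ρ n v = (θ n : ℂ) • v)
    (hT : ∀ t : linearCharacterStabilizer N M θ, ρ t v = (ψ t : ℂ) • v) :
    ∃ r : linearCharacterOrbit N M θ → M,
      LinearIndependent ℂ (fun i => ρ (r i) v) ∧
      Submodule.span ℂ (Set.range fun i => ρ (r i) v) = ⊤ ∧
      ∀ m : M, ∃ t : linearCharacterStabilizer N M θ,
        (m : G) = r (Set.rangeFactorization _ m) * t := by
  choose r hr using fun i : linearCharacterOrbit N M θ => i.2
  have h3 : ∀ m : M, ∃ t : linearCharacterStabilizer N M θ,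
        (m : G) = r (Set.rangeFactorization _ m) * t := fun m =>
    ⟨⟨_, inv_mul_mem_linearCharacterStabilizer (hr (Set.rangeFactorization _ m))⟩, by simp⟩
  refine ⟨r, ?_, ?_, h3⟩
  · refine linearIndependent_of_injective_weights (ρ.comp N.subtype) _ (fun i h => hv ?_)
      (fun i => i.1) Subtype.val_injective fun i n => ?_
    · have := congrArg (ρ (r i : G)⁻¹) h
      rwa [← Module.End.mul_apply, ← map_mul, inv_mul_cancel, map_one, map_zero] at this
    · rw [MonoidHom.comp_apply, N.coe_subtype, apply_conj_weight hN, ← hr i]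
      rfl
  · rw [eq_top_iff, ← hρ.span_eq_top hv hNM hN, Submodule.span_le]
    rintro _ ⟨m, rfl⟩
    obtain ⟨t, ht⟩ := h3 m
    simp only [SetLike.mem_coe]
    rw [ht, map_mul, Module.End.mul_apply, hT, map_smul]
    exact Submodule.smul_mem _ _ (Submodule.subset_span ⟨_, rfl⟩)

omit [Finite G] in
-- The degree does not involve `ψ`. Hence representations built from the same `θ` with different `ψ`
-- can be compared by `GC*`.
theorem Representation.IsIrreducible.finrank_eq_card_orbit (hρ : ρ.IsIrreducible) (hv : v ≠ 0)
    (hNM : N.IsComplement' M) (hN : ∀ n : N, ρ n v = (θ n : ℂ) • v)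
    (hT : ∀ t : linearCharacterStabilizer N M θ, ρ t v = (ψ t : ℂ) • v) :
    finrank ℂ V = Nat.card (linearCharacterOrbit N M θ) := by
  obtain ⟨r, h1, h2, -⟩ := hρ.exists_weight_family hv hNM hN hT
  exact finrank_eq_nat_card_basis (Basis.mk h1 h2.ge)

/-- The sum over `M` takes the same value at `v` and at `ψ(t)v`, so it kills `v` and all its
translates. On an invariant vector it is multiplication by `|M|`. -/
theorem Representation.IsIrreducible.finrank_invariants_eq_zero (hρ : ρ.IsIrreducible) (hv : v ≠ 0)
    (hNM : N.IsComplement' M) (hN : ∀ n : N, ρ n v = (θ n : ℂ) • v)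
    (hT : ∀ t : linearCharacterStabilizer N M θ, ρ t v = (ψ t : ℂ) • v) (hψ : ψ ≠ 1) :
    finrank ℂ (invariants (ρ.comp M.subtype : Representation ℂ M V)) = 0 := by
  have : Fintype M := Fintype.ofFinite M
  obtain ⟨t, ht⟩ : ∃ t, ψ t ≠ 1 := by
    by_contra! h
    exact hψ (MonoidHom.ext h)
  let A : V →ₗ[ℂ] V := ∑ m : M, ρ m
  have hA : ∀ k : M, ∀ w, A (ρ k w) = A w := by
    intro k w
    simp only [A, LinearMap.sum_apply]
    refine Fintype.sum_equiv (Equiv.mulRight k) _ _ fun m => ?_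
    simp
  have hAv : A v = 0 := by
    have h1 := hA ⟨t, t.2.1⟩ v
    simp only [hT, map_smul] at h1
    have h2 : ((ψ t : ℂ) - 1) • A v = 0 := by rw [sub_smul, h1, one_smul, sub_self]
    refine (smul_eq_zero.1 h2).resolve_left fun h => ht (Units.ext (sub_eq_zero.1 h))
  have hA0 : ∀ w, A w = 0 := by
    intro w
    have hw : w ∈ Submodule.span ℂ (Set.range fun m : M => ρ m v) := by
      rw [hρ.span_eq_top hv hNM hN]; trivial
    induction hw using Submodule.span_induction with
    | zero => simp
    | add x y _ _ hx hy => rw [map_add, hx, hy, add_zero]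
    | smul a x _ hx => rw [map_smul, hx, smul_zero]
    | mem x hx =>
      obtain ⟨m, rfl⟩ := hx
      rw [hA, hAv]
  have hbot : invariants (ρ.comp M.subtype : Representation ℂ M V) = ⊥ := by
    rw [eq_bot_iff]
    intro w hw
    have h1 := hA0 w
    have h2 : ∀ m : M, ρ m w = w := hw
    simp only [A, LinearMap.sum_apply, h2, Finset.sum_const, Finset.card_univ] at h1
    rw [← Nat.cast_smul_eq_nsmul ℂ] at h1
    exact (smul_eq_zero.1 h1).resolve_left (by exact_mod_cast Fintype.card_ne_zero)
  rw [hbot, finrank_bot]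

/-- The sum of the `M`-translates of `v` is invariant. In the basis of orbit representatives its
coefficients count fibres, so it is not zero. -/
theorem Representation.IsIrreducible.finrank_invariants_ne_zero [FiniteDimensional ℂ V]
    (hρ : ρ.IsIrreducible) (hv : v ≠ 0)
    (hNM : N.IsComplement' M) (hN : ∀ n : N, ρ n v = (θ n : ℂ) • v)
    (hT : ∀ t : linearCharacterStabilizer N M θ, ρ t v = v) :
    finrank ℂ (invariants (ρ.comp M.subtype : Representation ℂ M V)) ≠ 0 := by
  classical
  have : Fintype M := Fintype.ofFinite M
  have : Fintype (linearCharacterOrbit N M θ) := Fintype.ofFinite _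
  obtain ⟨r, h1, -, h3⟩ := hρ.exists_weight_family (ψ := 1) hv hNM hN fun t => by
    rw [hT, MonoidHom.one_apply, Units.val_one, one_smul]
  have hw : ∑ m : M, ρ m v ∈ invariants (ρ.comp M.subtype : Representation ℂ M V) := by
    intro k
    rw [map_sum]
    refine Fintype.sum_equiv (Equiv.mulLeft k) _ _ fun m => ?_
    rw [Equiv.coe_mulLeft, Subgroup.coe_mul, map_mul, Module.End.mul_apply]
    rfl
  intro h0
  have hbot := Submodule.finrank_eq_zero.1 h0
  rw [hbot, Submodule.mem_bot] at hw
  have h4 : ∀ m : M, ρ m v = ρ (r (Set.rangeFactorization _ m)) v := by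
    intro m
    obtain ⟨t, ht⟩ := h3 m
    conv_lhs => rw [ht, map_mul, Module.End.mul_apply, hT]
  rw [Finset.sum_congr rfl fun m _ => h4 m] at hw
  rw [← Finset.sum_fiberwise (s := Finset.univ)
    (g := fun m : M => (Set.rangeFactorization _ m : linearCharacterOrbit N M θ))] at hw
  have h5 : ∑ i : linearCharacterOrbit N M θ, ((Finset.univ.filter fun m : M =>
      (Set.rangeFactorization _ m : linearCharacterOrbit N M θ) = i).card : ℂ) • ρ (r i) v = 0 := by
    rw [← hw]
    refine Finset.sum_congr rfl fun i _ => ?_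
    rw [Nat.cast_smul_eq_nsmul, ← Finset.sum_const]
    refine Finset.sum_congr rfl fun m hm => ?_
    rw [(Finset.mem_filter.1 hm).2]
  have h6 := Fintype.linearIndependent_iff.1 h1 _ h5 (Set.rangeFactorization _ 1)
  rw [Nat.cast_eq_zero, Finset.card_eq_zero] at h6
  have : (1 : M) ∈ Finset.univ.filter fun m : M => (Set.rangeFactorization _ m :
    linearCharacterOrbit N M θ) = Set.rangeFactorization _ 1 := by simp
  rw [h6] at this
  simp at this

/-- This replaces induction from `NT`. The element `∑ θ(n)⁻¹ ψ(t)⁻¹ n t` has coefficient 1 at the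
identity because `N ∩ M = 1`, so it acts nontrivially on some irreducible representation. Any
nonzero vector in its image has the required weights. -/
theorem exists_irreducible_of_linearCharacter (hNM : N.IsComplement' M) (θ : N →* ℂˣ)
    (ψ : linearCharacterStabilizer N M θ →* ℂˣ) :
    ∃ (n : ℕ) (ρ : Representation ℂ G (Fin n → ℂ)), ρ.IsIrreducible ∧
      ∃ v ≠ 0, (∀ n : N, ρ n v = (θ n : ℂ) • v) ∧
        ∀ t : linearCharacterStabilizer N M θ, ρ t v = (ψ t : ℂ) • v := by
  classical
  have : Fintype N := Fintype.ofFinite N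
  have : Fintype (linearCharacterStabilizer N M θ) := Fintype.ofFinite _
  obtain ⟨n, ρ, hρ, w, hw⟩ := exists_irreducible_sum_ne_zero
    (fun p : N × linearCharacterStabilizer N M θ => (p.1 * p.2 : G))
    (fun p => (θ p.1 : ℂ)⁻¹ * (ψ p.2 : ℂ)⁻¹) 1 (by
      rw [Finset.sum_eq_single 1]
      · simp
      · rintro ⟨a, b⟩ - hab
        refine if_neg fun h => hab ?_
        simp only at h
        have ha : (a : G) ∈ N ⊓ M := by
          refine ⟨a.2, ?_⟩
          rw [eq_inv_of_mul_eq_one_left h]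
          exact M.inv_mem b.2.1
        rw [hNM.disjoint.eq_bot, Subgroup.mem_bot] at ha
        rw [ha, one_mul] at h
        exact Prod.ext (Subtype.ext ha) (Subtype.ext h)
      · simp)
  refine ⟨n, ρ, hρ, _, hw, fun m => ?_, fun t => ?_⟩
  · rw [map_sum, Finset.smul_sum]
    refine Fintype.sum_equiv ((Equiv.mulLeft m).prodCongr (Equiv.refl _)) _ _ fun p => ?_
    simp only [Equiv.prodCongr_apply, Prod.map_fst, Prod.map_snd, Equiv.coe_mulLeft,
      Equiv.refl_apply, Subgroup.coe_mul, map_smul, smul_smul, map_mul, Units.val_mul,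
      Module.End.mul_apply]
    congr 1
    field_simp
  · rw [map_sum, Finset.smul_sum]
    refine Fintype.sum_equiv ((MulAut.conjNormal (t : G) : MulAut N).toEquiv.prodCongr
      (Equiv.mulLeft t)) _ _ fun p => ?_
    have h1 : (t : G) * (p.1 * p.2) = (MulAut.conjNormal (t : G) p.1 : N) * (t * p.2) := by
      simp [MulAut.conjNormal_apply, mul_assoc]
    simp only [Equiv.prodCongr_apply, Prod.map_fst, Prod.map_snd, Equiv.coe_mulLeft,
      MulEquiv.toEquiv_eq_coe, EquivLike.coe_coe, Subgroup.coe_mul, map_smul, smul_smul,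
      t.2.2 p.1, map_mul ψ, Units.val_mul]
    rw [← Module.End.mul_apply, ← map_mul, h1]
    congr 1
    field_simp

end Induced

/-- In a solvable `GC*`-group with normal subgroup `N` complemented by `M`, the stabilizer in `M`
of a linear character of `N` is trivial or all of `M`. -/
theorem IsGCStar.linearCharacterStabilizer_eq_bot [Finite G] (hG : IsGCStar G)
    [Group.IsSolvable G] {N M : Subgroup G} [N.Normal] (hNM : N.IsComplement' M) (θ : N →* ℂˣ)
    (hθ : ∃ m ∈ M, ∃ n, θ (MulAut.conjNormal m n) ≠ θ n) :
    linearCharacterStabilizer N M θ = ⊥ := by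
  set T := linearCharacterStabilizer N M θ with hTdef
  have hψ : ∀ ψ : T →* ℂˣ, ψ = 1 := by
    by_contra! hψ
    obtain ⟨ψ, hψ⟩ := hψ
    obtain ⟨n₁, ρ, hρ, v, hv, hvN, hvT⟩ := exists_irreducible_of_linearCharacter hNM θ 1
    obtain ⟨n₂, σ, hσ, w, hw, hwN, hwT⟩ := exists_irreducible_of_linearCharacter hNM θ ψ
    have d1 := hρ.finrank_eq_card_orbit hv hNM hvN hvT
    have d2 := hσ.finrank_eq_card_orbit hw hNM hwN hwT
    have hne : finrank ℂ (Fin n₁ → ℂ) ≠ 1 := by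
      rw [d1]
      intro h
      obtain ⟨m, hm, n, hn⟩ := hθ
      have := (Nat.card_eq_one_iff_unique.1 h).1
      have h1 := congrArg Subtype.val (Subsingleton.elim
        (Set.rangeFactorization _ ⟨m⁻¹, inv_mem hm⟩ : linearCharacterOrbit N M θ)
        (Set.rangeFactorization _ 1))
      have h2 := DFunLike.congr_fun h1 n
      apply hn
      simpa using h2
    -- Both degrees equal the orbit size, but only the representation with trivial `ψ` has nonzero
    -- `M`-invariants.
    have h1 := hG.finrank_invariants_eq hρ hσ hne (d1.trans d2.symm) M
    rw [hσ.finrank_invariants_eq_zero hw hNM hwN hwT hψ] at h1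
    exact hρ.finrank_invariants_ne_zero hv hNM hvN (by simpa using hvT) h1
  by_contra hT
  have : Nontrivial T := (Subgroup.nontrivial_iff_ne_bot T).2 hT
  have h1 := Group.IsSolvable.commutator_lt_top_of_nontrivial T
  obtain ⟨t, -, ht⟩ := SetLike.exists_of_lt h1
  have h2 : Abelianization.of t ≠ 1 := fun h => ht ((QuotientGroup.eq_one_iff t).1 h)
  obtain ⟨φ, hφ⟩ := CommGroup.exists_apply_ne_one_of_hasEnoughRootsOfUnity (Abelianization T) ℂ h2
  exact hφ (DFunLike.congr_fun (hψ (φ.comp Abelianization.of)) t)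

end SemidirectStabilizer

/-! ### The nilpotent residual of a finite group -/

section NilpotentResidual

open scoped commutatorElement

variable {G : Type*} [Group G]

theorem nilpotentResidual_le_lowerCentralSeries (n : ℕ) :
    nilpotentResidual G ≤ (⊤ : Subgroup G).lowerCentralSeries n := iInf_le _ n

instance nilpotentResidual_normal : (nilpotentResidual G).Normal :=
  Subgroup.normal_iInf_normal fun _ => inferInstance

theorem nilpotentResidual_le_commutator : nilpotentResidual G ≤ commutator G :=
  (nilpotentResidual_le_lowerCentralSeries 1).trans_eq Subgroup.top_lowerCentralSeries_one

variable [Finite G]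

theorem exists_lowerCentralSeries_eq_nilpotentResidual :
    ∃ n, ∀ m ≥ n, (⊤ : Subgroup G).lowerCentralSeries m = nilpotentResidual G := by
  obtain ⟨n, hn⟩ := WellFoundedGT.monotone_chain_condition (α := (Subgroup G)ᵒᵈ)
    ⟨fun n => OrderDual.toDual ((⊤ : Subgroup G).lowerCentralSeries n),
      fun a b hab => Subgroup.lowerCentralSeries_antitone _ hab⟩
  have hn' : ∀ m, n ≤ m → (⊤ : Subgroup G).lowerCentralSeries n =
      (⊤ : Subgroup G).lowerCentralSeries m := hn
  have h1 : (⊤ : Subgroup G).lowerCentralSeries n = nilpotentResidual G := by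
    refine le_antisymm (le_iInf fun m => ?_) (nilpotentResidual_le_lowerCentralSeries n)
    rcases le_total n m with h | h
    · exact (hn' m h).le
    · exact Subgroup.lowerCentralSeries_antitone _ h
  exact ⟨n, fun m hm => (hn' m hm).symm.trans h1⟩

theorem commutator_nilpotentResidual_top :
    ⁅nilpotentResidual G, (⊤ : Subgroup G)⁆ = nilpotentResidual G := by
  obtain ⟨n, hn⟩ := exists_lowerCentralSeries_eq_nilpotentResidual (G := G)
  have h1 := hn (n + 1) (Nat.le_succ n)
  rwa [Subgroup.lowerCentralSeries_succ, hn n le_rfl] at h1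

theorem isNilpotent_iff_nilpotentResidual_eq_bot :
    Group.IsNilpotent G ↔ nilpotentResidual G = ⊥ := by
  rw [Subgroup.nilpotent_iff_lowerCentralSeries]
  obtain ⟨n, hn⟩ := exists_lowerCentralSeries_eq_nilpotentResidual (G := G)
  constructor
  · rintro ⟨m, hm⟩
    rw [eq_bot_iff, ← hm]
    exact nilpotentResidual_le_lowerCentralSeries m
  · intro h
    exact ⟨n, (hn n le_rfl).trans h⟩

theorem nilpotentResidual_quotient (N : Subgroup G) [N.Normal] :
    nilpotentResidual (G ⧸ N) = (nilpotentResidual G).map (QuotientGroup.mk' N) := by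
  obtain ⟨n, hn⟩ := exists_lowerCentralSeries_eq_nilpotentResidual (G := G)
  obtain ⟨m, hm⟩ := exists_lowerCentralSeries_eq_nilpotentResidual (G := G ⧸ N)
  rw [← hn (max n m) (le_max_left _ _), ← hm (max n m) (le_max_right _ _),
    Subgroup.map_lowerCentralSeries, Subgroup.map_top_of_surjective _
      (QuotientGroup.mk'_surjective N)]

theorem isNilpotent_quotient_iff (N : Subgroup G) [N.Normal] :
    Group.IsNilpotent (G ⧸ N) ↔ nilpotentResidual G ≤ N := by
  rw [isNilpotent_iff_nilpotentResidual_eq_bot, nilpotentResidual_quotient,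
    Subgroup.map_eq_bot_iff, QuotientGroup.ker_mk']

end NilpotentResidual

/-! ### Minimal normal subgroups, and fixed linear characters -/

section MinimalNormal

open scoped commutatorElement

variable {G : Type*} [Group G] [Finite G]

theorem Subgroup.exists_minimal_normal_le {R : Subgroup G} [R.Normal] (hR : R ≠ ⊥) :
    ∃ N : Subgroup G, N.Normal ∧ N ≤ R ∧ N ≠ ⊥ ∧
      ∀ K : Subgroup G, K.Normal → K ≤ N → K = ⊥ ∨ K = N := by
  obtain ⟨N, hN⟩ := (Set.toFinite {N : Subgroup G | N.Normal ∧ N ≤ R ∧ N ≠ ⊥}).exists_minimal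
    ⟨R, inferInstance, le_rfl, hR⟩
  refine ⟨N, hN.prop.1, hN.prop.2.1, hN.prop.2.2, fun K hK hKN => ?_⟩
  by_cases h : K = ⊥
  · exact Or.inl h
  · exact Or.inr (le_antisymm hKN (hN.le_of_le ⟨hK, hKN.trans hN.prop.2.1, h⟩ hKN))

/-- Minimal normal subgroups of a solvable group are abelian `p`-groups. -/
theorem Subgroup.exists_isPGroup_of_minimal_normal [Group.IsSolvable G] {N : Subgroup G} [N.Normal]
    (hN : N ≠ ⊥) (hmin : ∀ K : Subgroup G, K.Normal → K ≤ N → K = ⊥ ∨ K = N) :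
    (∀ a ∈ N, ∀ b ∈ N, a * b = b * a) ∧ ∃ p : ℕ, p.Prime ∧ IsPGroup p N := by
  have hcomm : ∀ a ∈ N, ∀ b ∈ N, a * b = b * a := by
    have h1 := Group.IsSolvable.commutator_lt_of_ne_bot hN
    have h2 := (hmin ⁅N, N⁆ inferInstance h1.le).resolve_right h1.ne
    intro a ha b hb
    have h3 := Subgroup.commutator_mem_commutator ha hb
    rw [h2, Subgroup.mem_bot, commutatorElement_eq_one_iff_mul_comm] at h3
    exact h3
  refine ⟨hcomm, ?_⟩
  have h1 : Nat.card N ≠ 1 := fun h => hN (N.eq_bot_of_card_eq h)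
  obtain ⟨p, hpp, hpd⟩ := Nat.exists_prime_and_dvd h1
  have := Fact.mk hpp
  refine ⟨p, hpp, ?_⟩
  -- The `p`-torsion of the abelian group `N` is normal in `G` and nontrivial by Cauchy, so it is
  -- all of `N`.
  let K : Subgroup G :=
    { carrier := {x | x ∈ N ∧ x ^ p = 1}
      one_mem' := ⟨one_mem _, one_pow _⟩
      mul_mem' := by
        rintro a b ⟨ha, ha'⟩ ⟨hb, hb'⟩
        exact ⟨mul_mem ha hb, by rw [Commute.mul_pow (hcomm a ha b hb), ha', hb', one_mul]⟩
      inv_mem' := by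
        rintro a ⟨ha, ha'⟩
        exact ⟨inv_mem ha, by rw [inv_pow, ha', inv_one]⟩ }
  have hK : K.Normal := ⟨fun a ha g => ⟨Subgroup.Normal.conj_mem ‹_› a ha.1 g, by
    rw [conj_pow, ha.2]; simp⟩⟩
  have hKN : K = N := by
    refine (hmin K hK fun x hx => hx.1).resolve_left fun h => ?_
    obtain ⟨x, hx⟩ := exists_prime_orderOf_dvd_card' (G := N) p hpd
    have h2 : (x : G) ∈ K := ⟨x.2, by
      rw [← Subgroup.coe_pow, ← hx, pow_orderOf_eq_one, Subgroup.coe_one]⟩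
    rw [h, Subgroup.mem_bot, OneMemClass.coe_eq_one] at h2
    rw [h2, orderOf_one] at hx
    exact hpp.one_lt.ne hx
  intro x
  have h2 : (x : G) ∈ K := hKN.symm ▸ x.2
  exact ⟨1, Subtype.ext (by simpa using h2.2)⟩

/-- A subgroup whose quotient by a normal `p`-subgroup is a `q`-group, `p ≠ q`, is generated
by that subgroup and a Sylow `q`-subgroup. -/
theorem Sylow.le_sup_map_of_isPGroup {q : ℕ} [Fact q.Prime] {N H : Subgroup G} [N.Normal]
    (hH : IsPGroup q (H.map (QuotientGroup.mk' N))) (hNH : N ≤ H) (P : Sylow q H) :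
    H ≤ N ⊔ (P : Subgroup H).map H.subtype := by
  have h1 : IsPGroup q (H ⧸ N.subgroupOf H) := by
    intro x
    induction x using QuotientGroup.induction_on with
    | H x =>
      obtain ⟨k, hk⟩ := hH ⟨QuotientGroup.mk' N x, Subgroup.mem_map_of_mem _ x.2⟩
      refine ⟨k, ?_⟩
      rw [← QuotientGroup.mk_pow, QuotientGroup.eq_one_iff, Subgroup.mem_subgroupOf]
      have := congrArg Subtype.val hk
      simp only [Subgroup.coe_pow, Subgroup.coe_one, ← map_pow] at this
      simpa using (QuotientGroup.eq_one_iff _).1 this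
  obtain ⟨n, hn⟩ := IsPGroup.iff_card.1 h1
  -- The index divides a power of `q`, and it is prime to `q` because the join contains a Sylow
  -- `q`-subgroup.
  have h2 : (N.subgroupOf H ⊔ P).index ∣ q ^ n := by
    rw [← hn]
    exact Subgroup.index_dvd_of_le le_sup_left
  have h3 : ¬ q ∣ (N.subgroupOf H ⊔ P).index := fun h =>
    P.not_dvd_index (h.trans (Subgroup.index_dvd_of_le le_sup_right))
  have h4 : (N.subgroupOf H ⊔ P).index = 1 := by
    obtain ⟨k, -, hk⟩ := (Nat.dvd_prime_pow Fact.out).1 h2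
    rcases Nat.eq_zero_or_pos k with rfl | h
    · simpa using hk
    · exact absurd (hk ▸ dvd_pow_self q h.ne') h3
  rw [Subgroup.index_eq_one] at h4
  have h5 := congrArg (Subgroup.map H.subtype) h4
  rw [Subgroup.map_sup, Subgroup.subgroupOf_map_subtype, inf_eq_left.2 hNH, ← MonoidHom.range_eq_map,
    Subgroup.range_subtype] at h5
  exact h5.ge

/-- If the normal abelian `p`-subgroup `N` is complemented by `M` with order divisible by `p`,
then some nontrivial linear character of `N` is fixed by a nontrivial element of `M`. -/
theorem exists_linearCharacter_fixed {p : ℕ} [Fact p.Prime] {N M : Subgroup G} [N.Normal]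
    (hN : N ≠ ⊥) (hcomm : ∀ a ∈ N, ∀ b ∈ N, a * b = b * a) (hp : IsPGroup p N)
    (hM : p ∣ Nat.card M) :
    ∃ θ : N →* ℂˣ, θ ≠ 1 ∧ linearCharacterStabilizer N M θ ≠ ⊥ := by
  obtain ⟨m, hm⟩ := exists_prime_orderOf_dvd_card' (G := M) p hM
  let _ : CommGroup N := { (inferInstance : Group N) with
    mul_comm := fun a b => Subtype.ext (hcomm a a.2 b b.2) }
  let φ : MulAut N := MulAut.conjNormal (m : G)
  have hφ : φ ^ p = 1 := by
    rw [← map_pow, ← Subgroup.coe_pow, ← hm, pow_orderOf_eq_one, Subgroup.coe_one, map_one]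
  have hz : IsPGroup p (Subgroup.zpowers φ) := by
    refine IsPGroup.of_card_dvd_pow (n := 1) ?_
    rw [Nat.card_zpowers, pow_one]
    exact orderOf_dvd_of_pow_eq_one hφ
  have hdvd : p ∣ Nat.card N := by
    refine hp.card_eq_or_dvd.resolve_left fun h => hN (N.eq_bot_of_card_eq h)
  -- A `p`-group acting on `N`, whose order is divisible by `p`, fixes some point besides `1`.
  obtain ⟨x, hx, hx1⟩ := hz.exists_fixed_point_of_prime_dvd_card_of_fixed_point N hdvd
    (a := (1 : N)) (fun g => by
      rw [Subgroup.smul_def, MulAut.smul_def, map_one])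
  have hx2 : φ x = x := hx ⟨φ, Subgroup.mem_zpowers φ⟩
  -- This endomorphism kills `x`, so it is not surjective either. Any nontrivial character of its
  -- cokernel, pulled back to `N`, is fixed by `m`.
  let D : N →* N := MonoidHom.mk' (fun n => φ n * n⁻¹) fun a b => by
    rw [map_mul, mul_inv, mul_mul_mul_comm]
  have hD : ¬ Function.Injective D := fun h => hx1.symm (h (by simp [D, hx2]))
  rw [Finite.injective_iff_surjective] at hD
  have hrange : D.range ≠ ⊤ := fun h => hD (MonoidHom.range_eq_top.1 h)
  obtain ⟨y, -, hy⟩ := SetLike.exists_of_lt (lt_top_iff_ne_top.2 hrange)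
  have hy1 : QuotientGroup.mk' D.range y ≠ 1 := by simpa using hy
  obtain ⟨ψ, hψ⟩ := CommGroup.exists_apply_ne_one_of_hasEnoughRootsOfUnity (N ⧸ D.range) ℂ hy1
  refine ⟨ψ.comp (QuotientGroup.mk' D.range), fun h => hψ (DFunLike.congr_fun h y), fun h => ?_⟩
  have hmem : (m : G) ∈ linearCharacterStabilizer N M (ψ.comp (QuotientGroup.mk' D.range)) := by
    refine ⟨m.2, fun n => ?_⟩
    have h1 : QuotientGroup.mk' D.range (D n) = 1 := by
      rw [QuotientGroup.mk'_apply, QuotientGroup.eq_one_iff]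
      exact ⟨n, rfl⟩
    have h2 : φ n = D n * n := by simp [D]
    change ψ (QuotientGroup.mk' D.range (φ n)) = ψ (QuotientGroup.mk' D.range n)
    rw [h2, map_mul, h1, one_mul]
  rw [h, Subgroup.mem_bot, OneMemClass.coe_eq_one] at hmem
  rw [hmem, orderOf_one] at hm
  exact (Fact.out : p.Prime).one_lt.ne hm

end MinimalNormal

/-! ### The nilpotent residual is a Hall subgroup -/

section CoprimeResidual

open scoped commutatorElement

universe u

variable {G : Type*} [Group G]

theorem Subgroup.normal_of_sup_normalizers {M N H : Subgroup G} (h : M ⊔ N = ⊤)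
    (hM : M ≤ Subgroup.normalizer (H : Set G)) (hN : N ≤ Subgroup.normalizer (H : Set G)) :
    H.Normal := by
  rw [← Subgroup.normalizer_eq_top_iff, eq_top_iff, ← h]
  exact sup_le hM hN

theorem Subgroup.le_normalizer_of_forall_conj_mem {A H : Subgroup G}
    (h : ∀ g ∈ A, ∀ x ∈ H, g * x * g⁻¹ ∈ H) : A ≤ Subgroup.normalizer (H : Set G) := by
  intro g hg
  rw [Subgroup.mem_normalizer_iff]
  refine fun x => ⟨h g hg x, fun hx => ?_⟩
  simpa [mul_assoc] using h g⁻¹ (inv_mem hg) _ hx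

theorem Subgroup.isComplement'_of_disjoint_of_sup {N M : Subgroup G} [N.Normal]
    (hd : Disjoint N M) (h : M ⊔ N = ⊤) : N.IsComplement' M := by
  refine Subgroup.isComplement'_of_disjoint_and_mul_eq_univ hd ?_
  rw [← Subgroup.normal_mul, sup_comm, h, Subgroup.coe_top]

theorem IsPGroup.isPGroup_of_quotient {p : ℕ} {N : Subgroup G} [N.Normal] (hN : IsPGroup p N)
    (h : IsPGroup p (G ⧸ N)) : IsPGroup p G := by
  intro g
  obtain ⟨k, hk⟩ := h (QuotientGroup.mk' N g)
  rw [← map_pow, QuotientGroup.mk'_apply, QuotientGroup.eq_one_iff] at hk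
  obtain ⟨l, hl⟩ := hN ⟨_, hk⟩
  refine ⟨k + l, ?_⟩
  rw [pow_add, pow_mul]
  exact congrArg Subtype.val hl

variable [Finite G]

/-- A minimal normal abelian `p`-subgroup `N`, complemented by `M` of order divisible by `p`,
of a solvable `GC*`-group is centralized by `M`. -/
theorem IsGCStar.commute_of_prime_dvd_complement (hG : IsGCStar G) [Group.IsSolvable G] {p : ℕ}
    [Fact p.Prime] {N M : Subgroup G} [N.Normal] (hNM : N.IsComplement' M) (hN : N ≠ ⊥)
    (hmin : ∀ K : Subgroup G, K.Normal → K ≤ N → K = ⊥ ∨ K = N)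
    (hcomm : ∀ a ∈ N, ∀ b ∈ N, a * b = b * a) (hp : IsPGroup p N) (hM : p ∣ Nat.card M) :
    ∀ m ∈ M, ∀ n ∈ N, m * n * m⁻¹ = n := by
  obtain ⟨θ, hθ, hst⟩ := exists_linearCharacter_fixed hN hcomm hp hM
  have hinv : ∀ m ∈ M, ∀ n, θ (MulAut.conjNormal m n) = θ n := by
    by_contra! h
    exact hst (hG.linearCharacterStabilizer_eq_bot hNM θ h)
  have hinvN : ∀ m ∈ N, ∀ n, θ (MulAut.conjNormal m n) = θ n := by
    intro m hm n
    congr 1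
    apply Subtype.ext
    rw [MulAut.conjNormal_apply, hcomm m hm n n.2, mul_inv_cancel_right]
  -- `θ` is invariant under `M` by the stabilizer dichotomy, and under `N` because `N` is abelian.
  -- Minimality then makes `θ` faithful, and an invariant faithful character forces `M` to
  -- centralize `N`.
  have hK : (θ.ker.map N.subtype).Normal := by
    have aux : ∀ A : Subgroup G, (∀ m ∈ A, ∀ n, θ (MulAut.conjNormal m n) = θ n) →
        A ≤ Subgroup.normalizer (θ.ker.map N.subtype : Set G) := by
      refine fun A hA => Subgroup.le_normalizer_of_forall_conj_mem ?_
      rintro g hg _ ⟨x, hx, rfl⟩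
      exact ⟨MulAut.conjNormal g x, (hA g hg x).trans hx, MulAut.conjNormal_apply g x⟩
    exact Subgroup.normal_of_sup_normalizers (hNM.symm.sup_eq_top) (aux M hinv) (aux N hinvN)
  have hker : θ.ker = ⊥ := by
    rcases hmin _ hK (Subgroup.map_subtype_le _) with h | h
    · exact (Subgroup.map_eq_bot_iff_of_injective _ N.subtype_injective).1 h
    · exfalso
      apply hθ
      ext1 n
      have hn : (n : G) ∈ θ.ker.map N.subtype := h.symm ▸ n.2
      obtain ⟨k, hk, hkn⟩ := hn
      rw [← Subtype.ext hkn]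
      exact hk
  intro m hm n hn
  have h1 := (MonoidHom.ker_eq_bot_iff θ).1 hker (hinv m hm ⟨n, hn⟩)
  simpa using congrArg Subtype.val h1

/-- Above a normal `p`-subgroup inside the nilpotent residual there is a normal section of
order prime to `p`, if the rest of the residual has order prime to `p`. -/
theorem exists_normal_isPGroup_quotient [Group.IsSolvable G] {p : ℕ} [Fact p.Prime]
    {N : Subgroup G} [N.Normal] (hnil : ¬ Group.IsNilpotent G) (hp : IsPGroup p N)
    (hcop : ¬ p ∣ Nat.card ((nilpotentResidual G).map (QuotientGroup.mk' N))) :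
    ∃ (q : ℕ) (S : Subgroup (G ⧸ N)), q.Prime ∧ q ≠ p ∧ S.Normal ∧ S ≠ ⊥ ∧ IsPGroup q S := by
  by_cases hR : (nilpotentResidual G).map (QuotientGroup.mk' N) = ⊥
  · have hnil' : Group.IsNilpotent (G ⧸ N) := by
      rw [isNilpotent_iff_nilpotentResidual_eq_bot, nilpotentResidual_quotient, hR]
    -- Here `G/N` is nilpotent but not a `p`-group, so it has a nontrivial normal Sylow `q`-subgroup
    -- with `q ≠ p`.
    have h1 : ¬ IsPGroup p (G ⧸ N) := fun h =>
      hnil (hp.isPGroup_of_quotient h).isNilpotent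
    obtain ⟨q, hq, hqd, hqp⟩ : ∃ q : ℕ, q.Prime ∧ q ∣ Nat.card (G ⧸ N) ∧ q ≠ p := by
      by_contra! h
      apply h1
      refine IsPGroup.of_card (n := (Nat.card (G ⧸ N)).primeFactorsList.length) ?_
      exact Nat.eq_prime_pow_of_unique_prime_dvd Nat.card_pos.ne' fun {q} hq hd => h q hq hd
    have := Fact.mk hq
    let P : Sylow q (G ⧸ N) := default
    refine ⟨q, P, hq, hqp, inferInstance, ?_, P.2⟩
    exact P.ne_bot_of_dvd_card hqd
  · have : ((nilpotentResidual G).map (QuotientGroup.mk' N)).Normal :=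
      Subgroup.Normal.map inferInstance _ (QuotientGroup.mk'_surjective N)
    obtain ⟨S, hS, hSR, hS1, hmin⟩ := Subgroup.exists_minimal_normal_le hR
    obtain ⟨-, q, hq, hSq⟩ := Subgroup.exists_isPGroup_of_minimal_normal hS1 hmin
    refine ⟨q, S, hq, ?_, hS, hS1, hSq⟩
    rintro rfl
    refine hcop ((hSq.card_eq_or_dvd.resolve_left fun h => hS1 (S.eq_bot_of_card_eq h)).trans ?_)
    exact Subgroup.card_dvd_of_le hSR

theorem Subgroup.card_map_mk'_mul_card {N R : Subgroup G} [N.Normal] (h : N ≤ R) :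
    Nat.card (R.map (QuotientGroup.mk' N)) * Nat.card N = Nat.card R := by
  have h1 := R.card_mul_index
  have h2 := (R.map (QuotientGroup.mk' N)).card_mul_index
  rw [Subgroup.index_map_eq R (QuotientGroup.mk'_surjective N) (by simpa using h)] at h2
  have h3 := N.card_mul_index
  rw [Subgroup.index_eq_card N, ← h2, ← h1] at h3
  have h4 : 0 < R.index := Nat.pos_of_ne_zero R.index_ne_zero_of_finite
  apply Nat.eq_of_mul_eq_mul_right h4
  rw [← h3]
  ring

/-- In a solvable `GC*`-group the nilpotent residual is a Hall subgroup. -/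
theorem IsGCStar.coprime_card_index_nilpotentResidual (n : ℕ) :
    ∀ (G : Type u) [Group G] [Finite G] [Group.IsSolvable G], IsGCStar G → Nat.card G = n →
      (Nat.card (nilpotentResidual G)).Coprime (nilpotentResidual G).index := by
  induction n using Nat.strong_induction_on with
  | _ n ih =>
  intro G _ _ _ hG hn
  by_cases hR : nilpotentResidual G = ⊥
  · rw [hR, Subgroup.card_bot]
    exact Nat.coprime_one_left _
  have hnil : ¬ Group.IsNilpotent G := fun h => hR (isNilpotent_iff_nilpotentResidual_eq_bot.1 h)
  have hquot : ∀ H : Subgroup G, H.Normal → H ≠ ⊥ → Nat.card (G ⧸ H) < n := by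
    intro H _ hH
    rw [← hn, ← Subgroup.index_eq_card, ← H.card_mul_index]
    have h1 : 1 < Nat.card H := (Subgroup.one_lt_card_iff_ne_bot H).2 hH
    have h2 : 0 < H.index := Nat.pos_of_ne_zero H.index_ne_zero_of_finite
    nlinarith
  obtain ⟨N, hNn, hNR, hN1, hmin⟩ := Subgroup.exists_minimal_normal_le hR
  obtain ⟨hcomm, p, hpp, hp⟩ := Subgroup.exists_isPGroup_of_minimal_normal hN1 hmin
  have := Fact.mk hpp
  have hIH := ih _ (hquot N hNn hN1) (G ⧸ N) (hG.quotient N) rfl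
  rw [nilpotentResidual_quotient, Subgroup.index_map_eq _ (QuotientGroup.mk'_surjective N)
    (by simpa using hNR)] at hIH
  by_contra hcop
  obtain ⟨r, hr, hr1, hr2⟩ := Nat.Prime.not_coprime_iff_dvd.1 hcop
  -- `R/N` is already Hall in `G/N` by induction and has the same index as `R`, so a common prime
  -- must come from `|N|`.
  have hrp : r = p := by
    rw [← Subgroup.card_map_mk'_mul_card hNR] at hr1
    have h1 : r ∣ Nat.card N := ((Nat.Prime.dvd_mul hr).1 hr1).resolve_left fun h =>
      Nat.Prime.not_coprime_iff_dvd.2 ⟨r, hr, h, hr2⟩ hIH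
    obtain ⟨k, hk⟩ := IsPGroup.iff_card.1 hp
    rw [hk] at h1
    exact (Nat.prime_dvd_prime_iff_eq hr hpp).1 (hr.dvd_of_dvd_pow h1)
  subst hrp
  have hpR : ¬ r ∣ Nat.card ((nilpotentResidual G).map (QuotientGroup.mk' N)) := fun h =>
    Nat.Prime.not_coprime_iff_dvd.2 ⟨r, hr, h, hr2⟩ hIH
  obtain ⟨q, S, hq, hqp, hSn, hS1, hSq⟩ := exists_normal_isPGroup_quotient hnil hp hpR
  have := Fact.mk hq
  set H₀ : Subgroup G := S.comap (QuotientGroup.mk' N) with hH₀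
  have hmap : H₀.map (QuotientGroup.mk' N) = S :=
    Subgroup.map_comap_eq_self_of_surjective (QuotientGroup.mk'_surjective N) S
  have hNH₀ : N ≤ H₀ := by
    intro x hx
    have : QuotientGroup.mk' N x = 1 := by simpa using hx
    rw [hH₀, Subgroup.mem_comap, this]
    exact one_mem _
  let P : Sylow q H₀ := default
  set H : Subgroup G := (P : Subgroup H₀).map H₀.subtype with hH
  have hHq : IsPGroup q H := P.2.map _
  have hH₀le : H₀ ≤ N ⊔ H := Sylow.le_sup_map_of_isPGroup (hmap.symm ▸ hSq) hNH₀ P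
  -- Frattini argument: `H` is Sylow in the normal subgroup `H₀ = NH`, so `G` is the product of `N`
  -- and the normalizer of `H`. Minimality of `N` leaves two possibilities for its intersection with
  -- this normalizer.
  set M : Subgroup G := Subgroup.normalizer (H : Set G) with hM
  have hHM : H ≤ M := Subgroup.le_normalizer
  have hsup : M ⊔ N = ⊤ := by
    rw [eq_top_iff, ← Sylow.normalizer_sup_eq_top P]
    exact sup_le le_sup_left (hH₀le.trans (sup_le le_sup_right (hHM.trans le_sup_left)))
  have hdisj : Disjoint N H := IsPGroup.disjoint_of_ne r q hqp.symm _ _ hp hHq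
  have hinter : (N ⊓ M).Normal := by
    refine Subgroup.normal_of_sup_normalizers hsup
      (Subgroup.le_normalizer_of_forall_conj_mem fun g hg x hx => ?_)
      (Subgroup.le_normalizer_of_forall_conj_mem fun g hg x hx => ?_)
    · exact ⟨hNn.conj_mem x hx.1 g, M.mul_mem (M.mul_mem hg hx.2) (M.inv_mem hg)⟩
    · rwa [hcomm g hg x hx.1, mul_inv_cancel_right]
  rcases hmin _ hinter inf_le_left with h | h
  -- Trivial intersection: `M` has order divisible by `p`, so it centralizes `N`. Then `N`
  -- centralizes `H` and so lies in `M`, a contradiction.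
  · have hcompl : N.IsComplement' M :=
      Subgroup.isComplement'_of_disjoint_of_sup (disjoint_iff.2 h) hsup
    have hrM : r ∣ Nat.card M := by
      rw [← hcompl.symm.index_eq_card]
      exact hr2.trans (Subgroup.index_dvd_of_le hNR)
    have hc := hG.commute_of_prime_dvd_complement hcompl hN1 hmin hcomm hp hrM
    apply hN1
    rw [eq_bot_iff, ← h]
    refine le_inf le_rfl (Subgroup.le_normalizer_of_forall_conj_mem fun g hg x hx => ?_)
    have h1 := hc x (hHM hx) g hg
    rw [mul_inv_eq_iff_eq_mul] at h1
    rwa [← h1, mul_inv_cancel_right]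
  -- Otherwise `H` is normal and induction applies to `G/H`. Passing to this quotient removes only
  -- factors of `q` from the index and leaves `N` embedded, so the prime `r` still violates
  -- coprimality.
  · have hMtop : M = ⊤ := by
      rw [← hsup, left_eq_sup, ← h]
      exact inf_le_right
    have hHn : H.Normal := Subgroup.normalizer_eq_top_iff.1 hMtop
    have hH1 : H ≠ ⊥ := by
      intro h1
      rw [h1, sup_bot_eq] at hH₀le
      apply hS1
      rw [← hmap, Subgroup.map_eq_bot_iff, QuotientGroup.ker_mk']
      exact hH₀le
    have hIH2 := ih _ (hquot H hHn hH1) (G ⧸ H) (hG.quotient H) rfl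
    rw [nilpotentResidual_quotient] at hIH2
    refine Nat.Prime.not_coprime_iff_dvd.2 ⟨r, hr, ?_, ?_⟩ hIH2
    · refine dvd_trans ?_ (Subgroup.card_dvd_of_le (Subgroup.map_mono hNR))
      refine (hp.map (QuotientGroup.mk' H)).card_eq_or_dvd.resolve_left fun h1 => hN1 ?_
      have h2 := Subgroup.eq_bot_of_card_eq _ h1
      rw [Subgroup.map_eq_bot_iff, QuotientGroup.ker_mk'] at h2
      exact disjoint_self.1 (hdisj.mono_right h2)
    · rw [Subgroup.index_map, QuotientGroup.ker_mk', QuotientGroup.range_mk', Subgroup.index_top,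
        mul_one]
      have h1 := Subgroup.relIndex_mul_index (le_sup_left : nilpotentResidual G ≤ nilpotentResidual G ⊔ H)
      rw [← h1] at hr2
      refine ((Nat.Prime.dvd_mul hr).1 hr2).resolve_left fun h2 => ?_
      rw [Subgroup.relIndex_sup_left] at h2
      have h3 := h2.trans (Subgroup.relIndex_dvd_card _ _)
      obtain ⟨k, hk⟩ := IsPGroup.iff_card.1 hHq
      rw [hk] at h3
      exact hqp ((Nat.prime_dvd_prime_iff_eq hr hq).1 (hr.dvd_of_dvd_pow h3)).symm

end CoprimeResidual

/-! ### Abelian groups acting without fixed points are cyclic -/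

section FixedPointFreeAction

/-- A finite commutative group acting without nontrivial fixed points on a nontrivial finite
abelian group is cyclic. -/
theorem isCyclic_of_fixedPointFree {B W : Type*} [CommGroup B] [Finite B] [CommGroup W] [Finite W]
    [Nontrivial W] (f : B →* Monoid.End W) (hf : ∀ b ≠ 1, ∀ w ≠ 1, f b w ≠ w) : IsCyclic B := by
  let F : B →* AddMonoid.End (Additive W) :=
    { toFun := fun b => MonoidHom.toAdditive (f b)
      map_one' := by rw [map_one]; rfl
      map_mul' := fun a b => by rw [map_mul]; rfl }
  let R := MonoidAlgebra ℤ B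
  let _ : Module R (Additive W) :=
    Module.compHom (Additive W) (MonoidAlgebra.lift ℤ (AddMonoid.End (Additive W)) B F).toRingHom
  have hsmul : ∀ (b : B) (w : Additive W), (MonoidAlgebra.of ℤ B b : R) • w = F b w := by
    intro b w
    change (MonoidAlgebra.lift ℤ (AddMonoid.End (Additive W)) B F (MonoidAlgebra.of ℤ B b)) w = _
    rw [MonoidAlgebra.lift_of]
  have : Finite (Submodule R (Additive W)) :=
    Finite.of_injective (fun S : Submodule R (Additive W) => (S : Set (Additive W)))
      SetLike.coe_injective
  have hnt : (⊤ : Submodule R (Additive W)) ≠ ⊥ := top_ne_bot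
  obtain ⟨S, hS, -⟩ := (IsAtomic.eq_bot_or_exists_atom_le (⊤ : Submodule R (Additive W))).resolve_left
    hnt
  have hsim : IsSimpleModule R S := isSimpleModule_iff_isAtom.2 hS
  -- A simple submodule of `W` over the commutative ring `ℤ[B]` is `ℤ[B]/I` with `I` maximal. An
  -- element of `B` that becomes `1` there fixes the submodule pointwise, so `B` embeds in the units
  -- of a field.
  obtain ⟨I, hI, ⟨e⟩⟩ := isSimpleModule_iff_quot_maximal.1 hsim
  have : IsDomain (R ⧸ I) := Ideal.Quotient.isDomain I
  refine isCyclic_of_injective_ringHom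
    (((Ideal.Quotient.mk I : R →+* R ⧸ I) : R →* R ⧸ I).comp (MonoidAlgebra.of ℤ B)) ?_
  rw [injective_iff_map_eq_one]
  intro b hb
  by_contra hb1
  obtain ⟨s, hs, hs0⟩ := S.ne_bot_iff.1 hS.1
  refine hf b hb1 (Additive.toMul s) (fun h => hs0 (by simpa using h)) ?_
  have h1 : (MonoidAlgebra.of ℤ B b : R) • (⟨s, hs⟩ : S) = ⟨s, hs⟩ := by
    apply e.injective
    rw [map_smul]
    obtain ⟨r, hr⟩ := Ideal.Quotient.mk_surjective (e ⟨s, hs⟩)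
    rw [← hr, ← Ideal.Quotient.mk_eq_mk, ← Submodule.Quotient.mk_smul, smul_eq_mul]
    change Ideal.Quotient.mk I _ = _
    rw [map_mul]
    have : Ideal.Quotient.mk I (MonoidAlgebra.of ℤ B b) = 1 := hb
    rw [this, one_mul]
    rfl
  have h2 := congrArg Subtype.val h1
  simp only [Submodule.coe_smul] at h2
  rw [hsmul] at h2
  exact h2

end FixedPointFreeAction

/-! ### Abelian subgroups of the complement -/

section ComplementAbelianSubgroups

open scoped commutatorElement

variable {G : Type*} [Group G] [Finite G]

/-- In a solvable `GC*`-group, commutative subgroups of a complement of the nontrivial nilpotent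
residual are cyclic. -/
theorem IsGCStar.isCyclic_of_le_complement (hG : IsGCStar G) [Group.IsSolvable G]
    (hR : nilpotentResidual G ≠ ⊥) {L : Subgroup G} (hL : (nilpotentResidual G).IsComplement' L)
    (B : Subgroup G) (hBL : B ≤ L) [hB : IsMulCommutative B] : IsCyclic B := by
  set R := nilpotentResidual G with hRdef
  have hstab : ∀ θ : R →* ℂˣ, θ ≠ 1 → linearCharacterStabilizer R L θ = ⊥ := by
    intro θ hθ
    apply hG.linearCharacterStabilizer_eq_bot hL
    by_contra! h
    apply hθ
    -- A character invariant under `L`, and automatically under `R`, kills `[R, G] = R`.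
    have h1 : R ≤ θ.ker.map R.subtype := by
      conv_lhs => rw [hRdef, ← commutator_nilpotentResidual_top]
      rw [Subgroup.commutator_le]
      intro r hr g _
      have hg : g ∈ R ⊔ L := by rw [hL.sup_eq_top]; trivial
      obtain ⟨a, ha, l, hl, rfl⟩ := Subgroup.mem_sup_of_normal_left.1 hg
      have h2 : ∀ n, θ (MulAut.conjNormal (a * l) n) = θ n := by
        intro n
        rw [map_mul, MulAut.mul_apply]
        have h3 : MulAut.conjNormal a (MulAut.conjNormal l n : R) =
            (⟨a, ha⟩ : R) * (MulAut.conjNormal l n) * (⟨a, ha⟩ : R)⁻¹ := by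
          apply Subtype.ext
          simp
        rw [h3, map_mul, map_mul, map_inv, mul_comm, inv_mul_cancel_left, h l hl]
      refine ⟨⟨r, hr⟩ * (MulAut.conjNormal (a * l) ⟨r, hr⟩)⁻¹, ?_, ?_⟩
      · rw [SetLike.mem_coe, MonoidHom.mem_ker, map_mul, map_inv, h2, mul_inv_cancel]
      · rw [commutatorElement_def]
        simp [mul_assoc]
    ext1 n
    obtain ⟨k, hk, hkn⟩ := h1 n.2
    rw [← Subtype.ext hkn]
    exact hk
  let _ : CommGroup B := { (inferInstance : Group B) with
    mul_comm := fun a b => mul_comm' a b }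
  -- The inverse makes precomposition with conjugation a left action.
  let f : B →* Monoid.End (R →* ℂˣ) :=
    { toFun := fun b => MonoidHom.compHom' (MulAut.conjNormal (b : G)⁻¹ : MulAut R).toMonoidHom
      map_one' := by
        refine MonoidHom.ext fun θ => MonoidHom.ext fun n => ?_
        change θ (MulAut.conjNormal (1 : G)⁻¹ n) = θ n
        simp
      map_mul' := fun a b => by
        refine MonoidHom.ext fun θ => MonoidHom.ext fun n => ?_
        change θ (MulAut.conjNormal ((a * b : B) : G)⁻¹ n) =
          θ (MulAut.conjNormal (b : G)⁻¹ (MulAut.conjNormal (a : G)⁻¹ n))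
        rw [Subgroup.coe_mul, mul_inv_rev, map_mul, MulAut.mul_apply] }
  have : Finite (R →* ℂˣ) :=
    Finite.of_equiv (Abelianization R →* ℂˣ) Abelianization.lift.symm
  have hnt : Nontrivial (R →* ℂˣ) := by
    have : Nontrivial R := (Subgroup.nontrivial_iff_ne_bot R).2 hR
    obtain ⟨t, -, ht⟩ := SetLike.exists_of_lt (Group.IsSolvable.commutator_lt_top_of_nontrivial R)
    have h2 : Abelianization.of t ≠ 1 := fun h => ht ((QuotientGroup.eq_one_iff t).1 h)
    obtain ⟨φ, hφ⟩ :=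
      CommGroup.exists_apply_ne_one_of_hasEnoughRootsOfUnity (Abelianization R) ℂ h2
    exact ⟨φ.comp Abelianization.of, 1, fun h => hφ (DFunLike.congr_fun h t)⟩
  refine isCyclic_of_fixedPointFree f fun b hb θ hθ h => hb ?_
  have h1 : (b : G)⁻¹ ∈ linearCharacterStabilizer R L θ :=
    ⟨inv_mem (hBL b.2), fun n => DFunLike.congr_fun h n⟩
  rw [hstab θ hθ, Subgroup.mem_bot, inv_eq_one, OneMemClass.coe_eq_one] at h1
  exact h1

end ComplementAbelianSubgroups

/-! ### `p`-groups whose abelian subgroups are cyclic -/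

section CyclicAbelianSubgroups

open scoped commutatorElement

variable {G : Type*} [Group G]

/-- Collecting the factors `a` to the left moves them past `n.choose 2` factors `v`, each exchange
costing one `t`. -/
theorem mul_pow_of_central_commutator {a v t : G} (hva : v * a = a * v * t) (hta : Commute t a)
    (htv : Commute t v) (n : ℕ) : (a * v) ^ n = a ^ n * v ^ n * t ^ n.choose 2 := by
  have h1 : ∀ n : ℕ, v ^ n * a = a * v ^ n * t ^ n := by
    intro n
    induction n with
    | zero => simp
    | succ n ih =>
      calc v ^ (n + 1) * a = v ^ n * (v * a) := by rw [pow_succ, mul_assoc]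
        _ = (v ^ n * a) * v * t := by rw [hva]; simp only [mul_assoc]
        _ = a * v ^ n * (t ^ n * v) * t := by rw [ih]; simp only [mul_assoc]
        _ = a * v ^ (n + 1) * t ^ (n + 1) := by
          rw [(htv.pow_left n).eq, pow_succ, pow_succ]; simp only [mul_assoc]
  induction n with
  | zero => simp
  | succ n ih =>
    calc (a * v) ^ (n + 1) = a ^ n * v ^ n * (t ^ n.choose 2 * (a * v)) := by
          rw [pow_succ, ih]; simp only [mul_assoc]
      _ = a ^ n * (v ^ n * a) * v * t ^ n.choose 2 := by
          rw [((hta.mul_right htv).pow_left _).eq]; simp only [mul_assoc]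
      _ = a ^ (n + 1) * v ^ n * (t ^ n * v) * t ^ n.choose 2 := by
          rw [h1, pow_succ a]; simp only [mul_assoc]
      _ = a ^ (n + 1) * v ^ (n + 1) * (t ^ n * t ^ n.choose 2) := by
          rw [(htv.pow_left n).eq, pow_succ v]; simp only [mul_assoc]
      _ = _ := by
          rw [← pow_add, Nat.choose_succ_succ' n 1, Nat.choose_one_right]

theorem Subgroup.isCyclic_closure_pair (hcyc : ∀ B : Subgroup G, IsMulCommutative B → IsCyclic B)
    {x y : G} (hxy : Commute x y) : IsCyclic (Subgroup.closure {x, y}) := by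
  apply hcyc
  apply Subgroup.isMulCommutative_closure
  rintro a (rfl | rfl) b (rfl | rfl)
  · rfl
  · exact hxy.eq
  · exact hxy.eq.symm
  · rfl

variable [Finite G]

/-- Inside the cyclic group generated by `x` and `y`, the equation `d ^ n = 1` with `n = orderOf y`
has at most `n` solutions, and the powers of `y` already provide that many. -/
theorem mem_zpowers_of_commute_of_orderOf_dvd
    (hcyc : ∀ B : Subgroup G, IsMulCommutative B → IsCyclic B) {x y : G} (hxy : Commute x y)
    (hd : orderOf x ∣ orderOf y) : x ∈ Subgroup.zpowers y := by
  classical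
  have := Subgroup.isCyclic_closure_pair hcyc hxy
  have hx : x ∈ Subgroup.closure {x, y} := Subgroup.subset_closure (by simp)
  have hy : y ∈ Subgroup.closure {x, y} := Subgroup.subset_closure (by simp)
  have : Fintype (Subgroup.closure {x, y}) := Fintype.ofFinite _
  set D := Subgroup.closure {x, y}
  set X : D := ⟨x, hx⟩
  set Y : D := ⟨y, hy⟩
  have hpos : 0 < orderOf Y := orderOf_pos Y
  have h1 := IsCyclic.card_pow_eq_one_le (α := D) hpos
  have h2 : (Finset.univ.filter fun d : D => d ∈ Subgroup.zpowers Y) ⊆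
      Finset.univ.filter fun d : D => d ^ orderOf Y = 1 := by
    intro d hd
    obtain ⟨k, rfl⟩ := Subgroup.mem_zpowers_iff.1 (Finset.mem_filter.1 hd).2
    refine Finset.mem_filter.2 ⟨Finset.mem_univ _, ?_⟩
    rw [← zpow_natCast, zpow_comm, zpow_natCast, pow_orderOf_eq_one, one_zpow]
  have h3 : (Finset.univ.filter fun d : D => d ∈ Subgroup.zpowers Y).card = orderOf Y := by
    rw [← Nat.card_zpowers, Nat.card_eq_fintype_card, Fintype.card_subtype]
  have h4 := Finset.eq_of_subset_of_card_le h2 (by rw [h3]; exact h1)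
  have h5 : X ∈ Finset.univ.filter fun d : D => d ^ orderOf Y = 1 := by
    refine Finset.mem_filter.2 ⟨Finset.mem_univ _, ?_⟩
    rw [← orderOf_dvd_iff_pow_eq_one]
    simpa [X, Y] using hd
  rw [← h4] at h5
  obtain ⟨k, hk⟩ := Subgroup.mem_zpowers_iff.1 (Finset.mem_filter.1 h5).2
  exact Subgroup.mem_zpowers_iff.2 ⟨k, congrArg Subtype.val hk⟩

theorem IsPGroup.mem_zpowers_or_mem_zpowers {p : ℕ} [hp : Fact p.Prime] (hG : IsPGroup p G)
    (hcyc : ∀ B : Subgroup G, IsMulCommutative B → IsCyclic B) {x y : G} (hxy : Commute x y) :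
    x ∈ Subgroup.zpowers y ∨ y ∈ Subgroup.zpowers x := by
  obtain ⟨i, hi⟩ := IsPGroup.iff_orderOf.1 hG x
  obtain ⟨j, hj⟩ := IsPGroup.iff_orderOf.1 hG y
  rcases le_total i j with h | h
  · exact Or.inl (mem_zpowers_of_commute_of_orderOf_dvd hcyc hxy (by
      rw [hi, hj]; exact pow_dvd_pow p h))
  · exact Or.inr (mem_zpowers_of_commute_of_orderOf_dvd hcyc hxy.symm (by
      rw [hi, hj]; exact pow_dvd_pow p h))

/-- An element outside the centre, central modulo the centre and with central `p`-th power. -/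
theorem IsPGroup.exists_mem_second_center {p : ℕ} [hp : Fact p.Prime] (hG : IsPGroup p G)
    (hnc : ¬ IsMulCommutative G) : ∃ w : G, w ∉ Subgroup.center G ∧
      w ^ p ∈ Subgroup.center G ∧ ∀ l, ⁅w, l⁆ ∈ Subgroup.center G := by
  have hQ : IsPGroup p (G ⧸ Subgroup.center G) := hG.to_quotient _
  have hnt : Nontrivial (G ⧸ Subgroup.center G) := by
    by_contra h
    rw [not_nontrivial_iff_subsingleton] at h
    refine hnc ⟨⟨fun a b => ?_⟩⟩
    have h1 : b ∈ Subgroup.center G :=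
      (QuotientGroup.eq_one_iff b).1 (Subsingleton.elim _ _)
    exact Subgroup.mem_center_iff.1 h1 a
  have := hQ.center_nontrivial
  have hZ : IsPGroup p (Subgroup.center (G ⧸ Subgroup.center G)) := hQ.to_subgroup _
  have hd : p ∣ Nat.card (Subgroup.center (G ⧸ Subgroup.center G)) :=
    hZ.card_eq_or_dvd.resolve_left (Finite.one_lt_card.ne')
  obtain ⟨⟨x, hx⟩, hxo⟩ := exists_prime_orderOf_dvd_card' p hd
  obtain ⟨w, rfl⟩ := QuotientGroup.mk_surjective x
  rw [Subgroup.orderOf_mk] at hxo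
  refine ⟨w, fun hw => ?_, ?_, fun l => ?_⟩
  · rw [(QuotientGroup.eq_one_iff w).2 hw, orderOf_one] at hxo
    exact hp.out.one_lt.ne hxo
  · rw [← QuotientGroup.eq_one_iff, QuotientGroup.mk_pow, ← hxo, pow_orderOf_eq_one]
  · rw [← QuotientGroup.eq_one_iff]
    have h1 := Subgroup.mem_center_iff.1 hx (QuotientGroup.mk l)
    have h2 : ⁅(QuotientGroup.mk w : G ⧸ Subgroup.center G), QuotientGroup.mk l⁆ = 1 :=
      commutatorElement_eq_one_iff_mul_comm.2 h1.symm
    exact h2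

/-- Take `u = x * y ^ m` with `y ^ (p * m) = x ^ (-p)`. The main terms of `u ^ p` cancel and only
the central commutator contribution survives. It is noncentral because `x` and `y` do not commute.
-/
theorem exists_pow_eq_of_central_commutator {p : ℕ} {x y s : G} (hyx : y * x = x * y * s)
    (hs : ∀ g, Commute s g) (hxy : ¬ Commute x y) (h : x ^ p ∈ Subgroup.zpowers (y ^ p)) :
    ∃ u : G, u ∉ Subgroup.center G ∧ ∃ m : ℕ, u ^ p = (s ^ p.choose 2) ^ m := by
  obtain ⟨m, hm⟩ : ∃ m : ℕ, (y ^ p) ^ m = (x ^ p)⁻¹ := by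
    have := mem_powers_iff_mem_zpowers.2 (inv_mem h)
    exact this
  have hyx' : ∀ n : ℕ, y ^ n * x = x * y ^ n * s ^ n := by
    intro n
    induction n with
    | zero => simp
    | succ n ih =>
      calc y ^ (n + 1) * x = y ^ n * (y * x) := by rw [pow_succ, mul_assoc]
        _ = (y ^ n * x) * y * s := by rw [hyx]; simp only [mul_assoc]
        _ = x * y ^ n * (s ^ n * y) * s := by rw [ih]; simp only [mul_assoc]
        _ = x * y ^ (n + 1) * s ^ (n + 1) := by
          rw [((hs y).pow_left n).eq, pow_succ, pow_succ]; simp only [mul_assoc]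
  refine ⟨x * y ^ m, fun hu => hxy ?_, m, ?_⟩
  · have h1 : x * y ^ m * y = y * (x * y ^ m) := (Subgroup.mem_center_iff.1 hu y).symm
    rw [mul_assoc, ← pow_succ, pow_succ', ← mul_assoc, ← mul_assoc] at h1
    exact mul_right_cancel h1
  · rw [mul_pow_of_central_commutator (hyx' m) ((hs _).pow_left m) ((hs _).pow_left m),
      ← pow_mul, mul_comm m p, pow_mul, hm, mul_inv_cancel, one_mul, ← pow_mul, ← pow_mul, mul_comm]

/-- If all commutative subgroups of a `p`-group are cyclic and the group is not commutative, then
`p = 2` and the centre has order two. -/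
theorem IsPGroup.eq_two_of_isCyclic_of_not_comm {p : ℕ} [hp : Fact p.Prime] (hG : IsPGroup p G)
    (hcyc : ∀ B : Subgroup G, IsMulCommutative B → IsCyclic B) (hnc : ¬ IsMulCommutative G) :
    ∃ s w : G, s ≠ 1 ∧ s ^ 2 = 1 ∧ s ∈ commutator G ∧
      (∀ y : G, y ^ 2 = 1 → y = 1 ∨ y = s) ∧ (∀ z, z ∈ Subgroup.center G ↔ z = 1 ∨ z = s) ∧
      w ^ 2 = s ∧ w ∉ Subgroup.center G ∧ ∀ l, ⁅w, l⁆ = 1 ∨ ⁅w, l⁆ = s := by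
  obtain ⟨w, hwZ, hwp, hw⟩ := hG.exists_mem_second_center hnc
  obtain ⟨l, hl⟩ : ∃ l : G, ⁅w, l⁆ ≠ 1 := by
    by_contra! h
    exact hwZ (Subgroup.mem_center_iff.2 fun l =>
      (commutatorElement_eq_one_iff_mul_comm.1 (h l)).symm)
  obtain ⟨s, hs⟩ : ∃ s, s = ⁅w, l⁆ := ⟨_, rfl⟩
  rw [← hs] at hl
  have hsc : ∀ g, Commute s g := fun g => (Subgroup.mem_center_iff.1 (hs ▸ hw l) g).symm
  have hwl : w * l = l * w * s := by
    rw [← (hsc (l * w)).eq, hs, commutatorElement_def]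
    group
  have hlw : l * w = w * l * s⁻¹ := by rw [hwl]; group
  have hncomm : ¬ Commute w l := fun h => hl (hs ▸ commutatorElement_eq_one_iff_mul_comm.2 h.eq)
  have hwpc : ∀ g, Commute (w ^ p) g := fun g => (Subgroup.mem_center_iff.1 hwp g).symm
  have hwl' : ∀ n : ℕ, w ^ n * l = l * w ^ n * s ^ n := by
    intro n
    induction n with
    | zero => simp
    | succ n ih =>
      rw [pow_succ, mul_assoc, hwl, ← mul_assoc, ← mul_assoc, ih, mul_assoc (l * w ^ n),
        ((hsc w).pow_left n).eq]
      simp only [pow_succ, mul_assoc]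
  -- `w ^ p` is central, so its commutator with `l`, namely `s ^ p`, is trivial.
  have hsp : s ^ p = 1 := by
    have h1 := hwl' p
    rw [(hwpc l).eq] at h1
    simpa using h1.symm
  have hso : orderOf s = p := orderOf_eq_prime hsp hl
  have huniq : ∀ y : G, y ^ p = 1 → y ∈ Subgroup.zpowers s := by
    intro y hy
    refine mem_zpowers_of_commute_of_orderOf_dvd hcyc (hsc y).symm ?_
    rw [hso]
    exact orderOf_dvd_of_pow_eq_one hy
  have huniqc : ∀ y : G, y ^ p = 1 → y ∈ Subgroup.center G := by
    intro y hy
    obtain ⟨k, rfl⟩ := Subgroup.mem_zpowers_iff.1 (huniq y hy)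
    exact Subgroup.mem_center_iff.2 fun g => ((hsc g).zpow_left k).eq.symm
  obtain ⟨u, huZ, t, m, htp, hu⟩ : ∃ u : G, u ∉ Subgroup.center G ∧ ∃ (t : G) (m : ℕ),
      t ^ p = 1 ∧ u ^ p = (t ^ p.choose 2) ^ m := by
    rcases hG.mem_zpowers_or_mem_zpowers hcyc (hwpc (l ^ p)) with h | h
    · obtain ⟨u, hu, m, hm⟩ := exists_pow_eq_of_central_commutator hlw
        (fun g => (hsc g).inv_left) hncomm h
      exact ⟨u, hu, s⁻¹, m, by rw [inv_pow, hsp, inv_one], hm⟩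
    · obtain ⟨u, hu, m, hm⟩ := exists_pow_eq_of_central_commutator hwl hsc
        (fun h => hncomm h.symm) h
      exact ⟨u, hu, s, m, hsp, hm⟩
  -- For odd `p` the binomial `p.choose 2` is a multiple of `p`, so `u ^ p = 1`. But all solutions
  -- of `y ^ p = 1` are central, while `u` is not.
  have hp2 : p = 2 := by
    by_contra hp2
    have h1 : p ∣ p.choose 2 := hp.out.dvd_choose_self two_ne_zero
      (lt_of_le_of_ne hp.out.two_le (Ne.symm hp2))
    obtain ⟨c, hc⟩ := h1
    refine huZ (huniqc u ?_)
    rw [hu, hc, pow_mul, htp, one_pow, one_pow]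
  subst hp2
  have huniq2 : ∀ y : G, y ^ 2 = 1 → y = 1 ∨ y = s := by
    intro y hy
    obtain ⟨k, rfl⟩ := Subgroup.mem_zpowers_iff.1 (huniq y hy)
    rcases Int.even_or_odd' k with ⟨c, rfl | rfl⟩
    · left
      rw [zpow_mul, zpow_ofNat, hsp, one_zpow]
    · right
      rw [zpow_add, zpow_mul, zpow_ofNat, hsp, one_zpow, one_mul, zpow_one]
  have husq : u ^ 2 = s := by
    refine (huniq2 _ ?_).resolve_left fun h => huZ (huniqc u h)
    rw [hu, pow_right_comm, pow_right_comm t, htp, one_pow, one_pow]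
  -- A central square root `z` of `s` would give `(u * z⁻¹) ^ 2 = 1`, making `u` central.
  have hZsq : ∀ z ∈ Subgroup.center G, z ^ 2 ≠ s := by
    intro z hz hzs
    have h1 : Commute u z := Subgroup.mem_center_iff.1 hz u
    have h2 : (u * z⁻¹) ^ 2 = 1 := by
      rw [h1.inv_right.mul_pow, inv_pow, husq, hzs, mul_inv_cancel]
    have h3 := huniqc _ h2
    exact huZ (by simpa using mul_mem h3 hz)
  have hZ : ∀ z ∈ Subgroup.center G, z = 1 ∨ z = s := by
    intro z hz
    obtain ⟨k, hk⟩ := hG z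
    have h1 : ∀ k : ℕ, ∀ z ∈ Subgroup.center G, z ^ 2 ^ k = 1 → z ^ 2 = 1 := by
      intro k
      induction k with
      | zero =>
        intro z _ h
        simp only [pow_zero, pow_one] at h
        rw [h, one_pow]
      | succ k ih =>
        intro z hz h
        rw [pow_succ', pow_mul] at h
        have h2 := ih _ (pow_mem hz 2) h
        rcases huniq2 _ h2 with h3 | h3
        · exact h3
        · exact absurd h3 (hZsq z hz)
    exact huniq2 z (h1 k z hz hk)
  have hsZ : s ∈ Subgroup.center G := hs ▸ hw l
  refine ⟨s, w, hl, hsp, hs ▸ Subgroup.commutator_mem_commutator (Subgroup.mem_top _)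
    (Subgroup.mem_top _), huniq2, fun z => ⟨hZ z, ?_⟩, ?_, hwZ, fun l => hZ _ (hw l)⟩
  · rintro (rfl | rfl)
    · exact one_mem _
    · exact hsZ
  · exact (hZ _ hwp).resolve_left fun h => hwZ (huniqc w h)

end CyclicAbelianSubgroups

/-! ### Generalized quaternion groups, and why only `Q₈` is `GC*` -/

section GeneralizedQuaternion

open scoped commutatorElement
open Representation Module

variable {G : Type*} [Group G] [Finite G]

/-- A noncommutative `p`-group with cyclic commutative subgroups is generalized quaternion. -/
theorem IsPGroup.exists_quaternion_generators {p : ℕ} [hp : Fact p.Prime] (hG : IsPGroup p G)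
    (hcyc : ∀ B : Subgroup G, IsMulCommutative B → IsCyclic B) (hnc : ¬ IsMulCommutative G) :
    ∃ a l s : G, s ≠ 1 ∧ s ^ 2 = 1 ∧ s ∈ commutator G ∧ (∀ g, Commute s g) ∧
      (∀ y : G, y ^ 2 = 1 → y = 1 ∨ y = s) ∧ a ^ 2 ≠ 1 ∧ a * l = l * a⁻¹ ∧ l ^ 2 = s ∧
      l ∉ Subgroup.zpowers a ∧ ∀ g, g ∈ Subgroup.zpowers a ∨ l⁻¹ * g ∈ Subgroup.zpowers a := by
  obtain ⟨s, w, hs1, hs2, hsc, huniq, hZ, hws, hwZ, hw⟩ := hG.eq_two_of_isCyclic_of_not_comm hcyc hnc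
  have hsZ : s ∈ Subgroup.center G := (hZ s).2 (Or.inr rfl)
  have hscomm : ∀ g, Commute s g := fun g => (Subgroup.mem_center_iff.1 hsZ g).symm
  set C := Subgroup.centralizer {w} with hC
  have hwC : w ∈ C := Subgroup.mem_centralizer_singleton_iff.2 rfl
  -- If `C` were not commutative, the structure result applied to `C` would make every element of
  -- its centre square to `1`; but `w` is central in `C` and `w ^ 2 = s ≠ 1`.
  have hCcomm : IsMulCommutative C := by
    by_contra hCn
    have hcycC : ∀ B : Subgroup C, IsMulCommutative B → IsCyclic B := by
      intro B hB
      have h1 : IsMulCommutative (B.map C.subtype) := inferInstance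
      have h2 := hcyc _ h1
      exact (B.equivMapOfInjective C.subtype C.subtype_injective).isCyclic.2 h2
    obtain ⟨s', w', -, hs', -, -, hZ', -⟩ :=
      (hG.to_subgroup C).eq_two_of_isCyclic_of_not_comm hcycC hCn
    have h1 : (⟨w, hwC⟩ : C) ∈ Subgroup.center C := by
      refine Subgroup.mem_center_iff.2 fun g => Subtype.ext ?_
      exact Subgroup.mem_centralizer_singleton_iff.1 g.2
    have h2 : (⟨w, hwC⟩ : C) ^ 2 = 1 := by
      rcases (hZ' _).1 h1 with h | h
      · rw [h, one_pow]
      · rw [h, hs']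
    apply hs1
    rw [← hws]
    exact congrArg Subtype.val h2
  obtain ⟨⟨a, haC⟩, ha⟩ := (hcyc C hCcomm).exists_generator
  have hCa : ∀ g ∈ C, g ∈ Subgroup.zpowers a := by
    intro g hg
    obtain ⟨k, hk⟩ := Subgroup.mem_zpowers_iff.1 (ha ⟨g, hg⟩)
    exact Subgroup.mem_zpowers_iff.2 ⟨k, congrArg Subtype.val hk⟩
  have haC' : Subgroup.zpowers a ≤ C := Subgroup.zpowers_le.2 haC
  obtain ⟨l, hl⟩ : ∃ l, l ∉ C := by
    by_contra! h
    exact hwZ (Subgroup.mem_center_iff.2 fun g => Subgroup.mem_centralizer_singleton_iff.1 (h g))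
  have hnC : ∀ g, g ∉ C → w * g = g * w * s := by
    intro g hg
    have h1 : ⁅w, g⁆ = s := (hw g).resolve_left fun h => hg (by
      rw [hC, Subgroup.mem_centralizer_singleton_iff]
      exact (commutatorElement_eq_one_iff_mul_comm.1 h).symm)
    rw [← (hscomm (g * w)).eq, ← h1, commutatorElement_def]
    group
  -- `C` has index two: the commutator with `w` equals `s` at every element outside `C`, and the two
  -- factors `s` cancel.
  have hmul : ∀ g h, g ∉ C → h ∉ C → g⁻¹ * h ∈ C := by
    intro g h hg hh
    have h1 := hnC g hg
    have h2 := hnC h hh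
    have h3 : w * g⁻¹ = g⁻¹ * w * s := by
      have h4 : g⁻¹ * w * g = w * s := by rw [mul_assoc, h1]; group
      have h5 : w = g * (w * s) * g⁻¹ := by rw [← h4]; group
      conv_rhs => rw [h5]
      rw [← (hscomm (w)).eq]
      have h6 : g⁻¹ * (g * (s * w) * g⁻¹) * s = s * (w * g⁻¹ * s) := by group
      rw [h6, (hscomm (w * g⁻¹ * s)).eq, mul_assoc, mul_assoc, ← pow_two, hs2]
      simp
    rw [hC, Subgroup.mem_centralizer_singleton_iff]
    symm
    calc w * (g⁻¹ * h) = w * g⁻¹ * h := by group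
      _ = g⁻¹ * w * (s * h) := by rw [h3]; group
      _ = g⁻¹ * (w * h) * s := by rw [(hscomm h).eq]; group
      _ = g⁻¹ * h * w * (s ^ 2) := by rw [h2, pow_two]; group
      _ = g⁻¹ * h * w := by rw [hs2, mul_one]
  -- `g ^ 2` lies in the abelian group `C` and commutes with `g`, so it is central. It cannot be
  -- `1`, since the only square roots of `1` are `1` and `s`, both in `C`.
  have hsq : ∀ g, g ∉ C → g ^ 2 = s := by
    intro g hg
    have h1 : g ^ 2 ∈ C := by
      have hg' : g⁻¹ ∉ C := fun h => hg (by simpa using inv_mem h)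
      simpa [pow_two] using hmul g⁻¹ g hg' hg
    have h2 : g ^ 2 ∈ Subgroup.center G := by
      refine Subgroup.mem_center_iff.2 fun x => ?_
      by_cases hx : x ∈ C
      · exact congrArg Subtype.val (mul_comm' (⟨x, hx⟩ : C) ⟨_, h1⟩)
      · have h3 := hmul g x hg hx
        have h4 : g⁻¹ * x * g ^ 2 = g ^ 2 * (g⁻¹ * x) :=
          congrArg Subtype.val (mul_comm' (⟨_, h3⟩ : C) ⟨_, h1⟩)
        have h5 : x * g ^ 2 = g * (g⁻¹ * x * g ^ 2) := by group
        rw [h5, h4]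
        group
    refine ((hZ _).1 h2).resolve_left fun h => ?_
    rcases huniq g h with rfl | rfl
    · exact hg (one_mem _)
    · exact hg (Subgroup.mem_centralizer_singleton_iff.2 (hscomm w).eq)
  refine ⟨a, l, s, hs1, hs2, hsc, hscomm, huniq, ?_, ?_, hsq l hl, fun h => hl (haC' h), ?_⟩
  · intro ha2
    obtain ⟨k, hk⟩ := Subgroup.mem_zpowers_iff.1 (hCa w hwC)
    apply hs1
    rw [← hws, ← hk, ← zpow_natCast, zpow_comm, zpow_natCast, ha2, one_zpow]
  -- Comparing `(l * a) ^ 2 = s = l ^ 2` shows that `l` inverts `a`.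
  · have hla : l * a ∉ C := fun h => hl (by simpa using mul_mem h (inv_mem haC))
    have h1 := (hsq _ hla).trans (hsq l hl).symm
    rw [pow_two, pow_two, mul_assoc, mul_left_cancel_iff] at h1
    rw [eq_mul_inv_iff_mul_eq, mul_assoc]
    exact h1
  · intro g
    by_cases hg : g ∈ C
    · exact Or.inl (hCa g hg)
    · exact Or.inr (hCa _ (hmul l g hl hg))

/-- Irreducible representations of groups with generators as in the generalized quaternion
groups have dimension at most two. -/
theorem Representation.IsIrreducible.finrank_le_two {a l s : G} (hal : a * l = l * a⁻¹)
    (hl : l ^ 2 = s) (hsc : ∀ g, Commute s g)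
    (hgen : ∀ g, g ∈ Subgroup.zpowers a ∨ l⁻¹ * g ∈ Subgroup.zpowers a)
    {V : Type*} [AddCommGroup V] [Module ℂ V] [FiniteDimensional ℂ V]
    {ρ : Representation ℂ G V} (hρ : ρ.IsIrreducible) : finrank ℂ V ≤ 2 := by
  classical
  have h := (isIrreducible_iff_forall_stable ρ).1 hρ
  have := h.1
  obtain ⟨c, hc⟩ := Module.End.exists_eigenvalue (ρ a)
  obtain ⟨v, hv⟩ := hc.exists_hasEigenvector
  have hav : ρ a v = c • v := hv.apply_eq_smul
  have hc0 : c ≠ 0 := by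
    rintro rfl
    have h1 := congrArg (ρ a⁻¹) hav
    rw [← Module.End.mul_apply, ← map_mul, inv_mul_cancel, map_one, zero_smul, map_zero] at h1
    exact hv.2 h1
  have hav' : ρ a⁻¹ v = c⁻¹ • v := by
    have h1 := congrArg (ρ a⁻¹) hav
    rw [← Module.End.mul_apply, ← map_mul, inv_mul_cancel, map_one, map_smul] at h1
    rw [eq_inv_smul_iff₀ hc0]
    exact h1.symm
  obtain ⟨d, hd⟩ := hρ.exists_eq_smul (ρ s) fun g v => by
    rw [← Module.End.mul_apply, ← Module.End.mul_apply, ← map_mul, ← map_mul, (hsc g).eq]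
  -- For an eigenvector `v` of `a`, the vector `ρ l v` is an eigenvector for the inverse eigenvalue,
  -- and `l ^ 2 = s` acts as a scalar by Schur. So these two vectors span a stable subspace.
  set W := Submodule.span ℂ ((({v, ρ l v} : Finset V)) : Set V) with hW
  have hvW : v ∈ W := Submodule.subset_span (by simp)
  have hlW : ρ l v ∈ W := Submodule.subset_span (by simp)
  have hstab : ∀ g, ρ g v ∈ W → ρ g (ρ l v) ∈ W → ∀ x ∈ W, ρ g x ∈ W := by
    intro g h1 h2 x hx
    induction hx using Submodule.span_induction with
    | zero => simp
    | add x y _ _ hx hy => rw [map_add]; exact add_mem hx hy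
    | smul a x _ hx => rw [map_smul]; exact Submodule.smul_mem _ _ hx
    | mem x hx =>
      simp only [Finset.coe_insert, Finset.coe_singleton, Set.mem_insert_iff,
        Set.mem_singleton_iff] at hx
      rcases hx with rfl | rfl
      · exact h1
      · exact h2
  have hSa : ∀ x ∈ W, ρ a x ∈ W := by
    apply hstab
    · rw [hav]
      exact W.smul_mem _ hvW
    · rw [← Module.End.mul_apply, ← map_mul, hal, map_mul, Module.End.mul_apply, hav', map_smul]
      exact W.smul_mem _ hlW
  have hSl : ∀ x ∈ W, ρ l x ∈ W := by
    apply hstab _ hlW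
    rw [← Module.End.mul_apply, ← map_mul, ← pow_two, hl, hd]
    exact W.smul_mem _ hvW
  have hSpow : ∀ g ∈ Subgroup.zpowers a, ∀ x ∈ W, ρ g x ∈ W := by
    intro g hg
    obtain ⟨n, rfl⟩ := mem_powers_iff_mem_zpowers.2 hg
    simp only
    induction n with
    | zero => simp
    | succ n ih =>
      intro x hx
      rw [pow_succ, map_mul, Module.End.mul_apply]
      exact ih (Subgroup.npow_mem_zpowers a n) _ (hSa x hx)
  have hSt : ∀ g, ∀ x ∈ W, ρ g x ∈ W := by
    intro g x hx
    rcases hgen g with hg | hg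
    · exact hSpow g hg x hx
    · have : g = l * (l⁻¹ * g) := by group
      rw [this, map_mul, Module.End.mul_apply]
      exact hSl _ (hSpow _ hg x hx)
  have hWtop : W = ⊤ := (h.2 W hSt).resolve_left fun h0 => hv.2 (by
    rw [h0, Submodule.mem_bot] at hvW
    exact hvW)
  rw [← finrank_top, ← hWtop]
  exact (finrank_span_finset_le_card _).trans Finset.card_le_two

/-- The only generalized quaternion `GC*`-group is the quaternion group of order eight. -/
theorem IsGCStar.pow_four_eq_one (hG : IsGCStar G) {a l s : G} (hs1 : s ≠ 1) (hs2 : s ^ 2 = 1)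
    (hsG : s ∈ commutator G) (hal : a * l = l * a⁻¹) (hl : l ^ 2 = s) (hsc : ∀ g, Commute s g)
    (hgen : ∀ g, g ∈ Subgroup.zpowers a ∨ l⁻¹ * g ∈ Subgroup.zpowers a) : a ^ 4 = 1 := by
  by_contra ha4
  have hnorm : (Subgroup.zpowers s).Normal := by
    refine ⟨fun x hx g => ?_⟩
    obtain ⟨k, rfl⟩ := Subgroup.mem_zpowers_iff.1 hx
    rw [← ((hsc g).zpow_left k).eq, mul_inv_cancel_right]
    exact hx
  have hS : ¬ commutator G ≤ Subgroup.zpowers s := by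
    intro h
    -- Thus `G' ≤ ⟨s⟩` would give `a ^ 4 = 1`.
    have h1 : a ^ 2 = ⁅a, l⁆ := by
      rw [commutatorElement_def, hal]
      have : a = l * a⁻¹ * l⁻¹ := by rw [← hal]; group
      conv_lhs => rw [pow_two, this]
      group
    have h2 : a ^ 2 ∈ Subgroup.zpowers s := by
      rw [h1]
      exact h (Subgroup.commutator_mem_commutator (Subgroup.mem_top _) (Subgroup.mem_top _))
    obtain ⟨k, hk⟩ := Subgroup.mem_zpowers_iff.1 h2
    apply ha4
    rw [show 4 = 2 * 2 from rfl, pow_mul, ← hk, ← zpow_natCast, zpow_comm, zpow_natCast, hs2, one_zpow]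
  obtain ⟨n₁, ρ, hρ, hρ1, hρs⟩ := exists_irreducible_nonlinear_of_normal _ hS
  obtain ⟨n₂, σ, hσ, hσs⟩ := exists_irreducible_ne_one hs1
  have hσ1 : finrank ℂ (Fin n₂ → ℂ) ≠ 1 := by
    intro h
    obtain ⟨μ, hμ⟩ := apply_of_finrank_eq_one (ρ := σ) h
    refine hσs (LinearMap.ext fun v => ?_)
    rw [hμ, MonoidHom.eq_one_of_mem_commutator μ hsG]
    simp
  have hpos : ∀ {n : ℕ} {τ : Representation ℂ G (Fin n → ℂ)}, τ.IsIrreducible →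
      finrank ℂ (Fin n → ℂ) ≠ 1 → finrank ℂ (Fin n → ℂ) = 2 := by
    intro n τ hτ h1
    have := ((isIrreducible_iff_forall_stable τ).1 hτ).1
    have h2 := hτ.finrank_le_two hal hl hsc hgen
    have h3 : 0 < finrank ℂ (Fin n → ℂ) := finrank_pos
    omega
  -- Both representations have degree 2, but `s` acts trivially in `ρ` and nontrivially in `σ`.
  have h1 := hG.finrank_invariants_eq hρ hσ hρ1 ((hpos hρ hρ1).trans (hpos hσ hσ1).symm)
    (Subgroup.zpowers s)
  have e1 : invariants (ρ.comp (Subgroup.zpowers s).subtype :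
      Representation ℂ (Subgroup.zpowers s) (Fin n₁ → ℂ)) = ⊤ := by
    rw [eq_top_iff]
    intro v _ t
    rw [MonoidHom.comp_apply, Subgroup.coe_subtype, hρs t t.2]
    rfl
  rw [e1, finrank_top, hpos hρ hρ1, ← hpos hσ hσ1] at h1
  have e2 := Submodule.eq_top_of_finrank_eq h1.symm
  refine hσs (LinearMap.ext fun v => ?_)
  have h3 : v ∈ invariants (σ.comp (Subgroup.zpowers s).subtype :
      Representation ℂ (Subgroup.zpowers s) (Fin n₂ → ℂ)) := by rw [e2]; trivial
  exact h3 ⟨s, Subgroup.mem_zpowers s⟩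

omit [Finite G] in
/-- Recognition of the quaternion group of order eight. -/
theorem nonempty_mulEquiv_quaternionGroup_two {a l : G} (ha : orderOf a = 4) (hl : l ^ 2 = a ^ 2)
    (hal : a * l = l * a⁻¹) (hla : l ∉ Subgroup.zpowers a)
    (hgen : ∀ g, g ∈ Subgroup.zpowers a ∨ l⁻¹ * g ∈ Subgroup.zpowers a) :
    Nonempty (G ≃* QuaternionGroup 2) := by
  have ha4 : zmultiplesHom (Additive G) (Additive.ofMul a) ((2 * 2 : ℕ) : ℤ) = 0 := by
    rw [zmultiplesHom_apply, natCast_zsmul, ← ofMul_pow]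
    change Additive.ofMul (a ^ 4) = 0
    rw [← ha, pow_orderOf_eq_one, ofMul_one]
  -- Powers of `a` with exponents modulo 4, so that `a i` and `xa i` can go to `a ^ i` and `l * a ^
  -- i`.
  let P : ZMod (2 * 2) →+ Additive G := ZMod.lift (2 * 2) ⟨_, ha4⟩
  let f : ZMod (2 * 2) → G := fun i => (P i).toMul
  have hfint : ∀ k : ℤ, f k = a ^ k := by
    intro k
    change (P (k : ZMod (2 * 2))).toMul = _
    rw [ZMod.lift_coe, zmultiplesHom_apply]
    rfl
  have hadd : ∀ i j, f (i + j) = f i * f j := fun i j => by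
    change (P (i + j)).toMul = _
    rw [map_add]
    rfl
  have hneg : ∀ i, f (-i) = (f i)⁻¹ := fun i => by
    change (P (-i)).toMul = _
    rw [map_neg]
    rfl
  have hsub : ∀ i j, f (i - j) = f i * (f j)⁻¹ := fun i j => by
    rw [sub_eq_add_neg, hadd, hneg]
  have hsurj : ∀ i : ZMod (2 * 2), ∃ k : ℤ, (k : ZMod (2 * 2)) = i := ZMod.intCast_surjective
  have hfa : ∀ i, f i ∈ Subgroup.zpowers a := by
    intro i
    obtain ⟨k, rfl⟩ := hsurj i
    rw [hfint]
    exact Subgroup.zpow_mem_zpowers a k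
  have hfl : ∀ i, f i * l = l * (f i)⁻¹ := by
    intro i
    obtain ⟨k, rfl⟩ := hsurj i
    rw [hfint]
    have h1 : l * a⁻¹ * l⁻¹ = a := by rw [← hal]; group
    have h2 : (l * a⁻¹ * l⁻¹) ^ k = l * a⁻¹ ^ k * l⁻¹ := conj_zpow
    rw [h1, inv_zpow] at h2
    conv_lhs => rw [h2]
    group
  have hinj : ∀ i j, f i = f j → i = j := by
    intro i j
    obtain ⟨k, rfl⟩ := hsurj i
    obtain ⟨m, rfl⟩ := hsurj j
    rw [hfint, hfint, zpow_eq_zpow_iff_modEq, ha]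
    exact fun h => (ZMod.intCast_eq_intCast_iff _ _ _).2 h
  have hcomm : ∀ i j, f i * f j = f j * f i := fun i j => by rw [← hadd, add_comm, hadd]
  have hf2 : f ((2 : ℕ) : ZMod (2 * 2)) = l ^ 2 := by
    have := hfint 2
    rw [hl]
    exact_mod_cast this
  let φ : QuaternionGroup 2 →* G := MonoidHom.mk' (fun
      | QuaternionGroup.a i => f i
      | QuaternionGroup.xa i => l * f i) (by
    rintro (i | i) (j | j)
    · simp only [QuaternionGroup.a_mul_a, hadd]
    · simp only [QuaternionGroup.a_mul_xa]
      rw [← mul_assoc, hfl, mul_assoc, hsub, ← hneg, hcomm]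
    · simp only [QuaternionGroup.xa_mul_a]
      rw [hadd, mul_assoc]
    · simp only [QuaternionGroup.xa_mul_xa]
      rw [hsub, hadd, hf2]
      have : l * f i * (l * f j) = l * (f i * l) * f j := by group
      rw [this, hfl, ← hneg, mul_assoc, mul_assoc, mul_assoc, hcomm, pow_two, mul_assoc])
  refine ⟨(MulEquiv.ofBijective φ ⟨?_, ?_⟩).symm⟩
  · rintro (i | i) (j | j) h
    · exact congrArg _ (hinj i j h)
    · have h' : f i = l * f j := h
      exact absurd (by rw [eq_mul_inv_of_mul_eq h'.symm]; exact mul_mem (hfa i) (inv_mem (hfa j))) hla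
    · have h' : l * f i = f j := h
      exact absurd (by rw [eq_mul_inv_of_mul_eq h']; exact mul_mem (hfa j) (inv_mem (hfa i))) hla
    · have h' : l * f i = l * f j := h
      exact congrArg _ (hinj i j (mul_left_cancel h'))
  · intro g
    rcases hgen g with h | h
    · obtain ⟨k, hk⟩ := Subgroup.mem_zpowers_iff.1 h
      exact ⟨QuaternionGroup.a k, (hfint k).trans hk⟩
    · obtain ⟨k, hk⟩ := Subgroup.mem_zpowers_iff.1 h
      refine ⟨QuaternionGroup.xa k, ?_⟩
      change l * f k = g
      rw [hfint, hk, mul_inv_cancel_left]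

/-- A noncommutative `p`-group in `GC*` with cyclic commutative subgroups is the quaternion group
of order eight. -/
theorem IsGCStar.nonempty_mulEquiv_quaternionGroup (hG : IsGCStar G) {p : ℕ} [Fact p.Prime]
    (hp : IsPGroup p G) (hcyc : ∀ B : Subgroup G, IsMulCommutative B → IsCyclic B)
    (hnc : ¬ IsMulCommutative G) : Nonempty (G ≃* QuaternionGroup 2) := by
  obtain ⟨a, l, s, hs1, hs2, hsG, hsc, huniq, ha2, hal, hl, hla, hgen⟩ :=
    hp.exists_quaternion_generators hcyc hnc
  have ha4 := hG.pow_four_eq_one hs1 hs2 hsG hal hl hsc hgen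
  have has : a ^ 2 = s := (huniq _ (by rw [← pow_mul]; exact ha4)).resolve_left ha2
  exact nonempty_mulEquiv_quaternionGroup_two (orderOf_eq_prime_pow (p := 2) (n := 1)
    (by simpa using ha2) (by simpa using ha4)) (hl.trans has.symm) hal hla hgen

end GeneralizedQuaternion

/-! ### Nilpotent `GC*`-groups with cyclic abelian subgroups -/

section NilpotentCase

open scoped commutatorElement

variable {G : Type*} [Group G]

/-- Otherwise `G/N` would be a nontrivial perfect solvable group. -/
theorem Subgroup.eq_top_of_commutator_sup [Group.IsSolvable G] {N : Subgroup G} [N.Normal]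
    (h : _root_.commutator G ⊔ N = ⊤) : N = ⊤ := by
  by_contra hN
  have : Nontrivial (G ⧸ N) := QuotientGroup.nontrivial_iff.2 hN
  refine (Group.IsSolvable.commutator_lt_top_of_nontrivial (G ⧸ N)).ne ?_
  have h1 : (_root_.commutator G).map (QuotientGroup.mk' N) = ⊤ := by
    have := congrArg (Subgroup.map (QuotientGroup.mk' N)) h
    rw [Subgroup.map_sup, QuotientGroup.map_mk'_self, sup_bot_eq,
      Subgroup.map_top_of_surjective _ (QuotientGroup.mk'_surjective N)] at this
    exact this
  rw [← h1, _root_.commutator_def, _root_.commutator_def, Subgroup.map_commutator,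
    Subgroup.map_top_of_surjective _ (QuotientGroup.mk'_surjective N)]

variable [Finite G]

theorem Subgroup.eq_top_of_forall_sylow_le {H : Subgroup G}
    (h : ∀ (p : ℕ) [Fact p.Prime], ∃ P : Sylow p G, (P : Subgroup G) ≤ H) : H = ⊤ := by
  rw [← Subgroup.index_eq_one]
  by_contra hne
  obtain ⟨p, hp, hdvd⟩ := Nat.exists_prime_and_dvd hne
  have := Fact.mk hp
  obtain ⟨P, hP⟩ := h p
  exact P.not_dvd_index (hdvd.trans (Subgroup.index_dvd_of_le hP))

theorem Sylow.commute_of_ne [Group.IsNilpotent G] {p q : ℕ} [Fact p.Prime] [Fact q.Prime]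
    (hpq : p ≠ q) (P : Sylow p G) (Q : Sylow q G) {x y : G} (hx : x ∈ P) (hy : y ∈ Q) :
    Commute x y :=
  Subgroup.commute_of_normal_of_disjoint (P : Subgroup G) (Q : Subgroup G) inferInstance
    inferInstance (IsPGroup.disjoint_of_ne p q hpq _ _ P.2 Q.2) x y hx hy

/-- Sylow subgroups for different primes commute, so if each were abelian, each would be central. -/
theorem exists_sylow_not_isMulCommutative [Group.IsNilpotent G] (hnc : ¬ IsMulCommutative G) :
    ∃ (p : ℕ) (_ : Fact p.Prime) (P : Sylow p G), ¬ IsMulCommutative (P : Subgroup G) := by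
  by_contra! hcon
  have hle : ∀ (p : ℕ) [Fact p.Prime] (P : Sylow p G), (P : Subgroup G) ≤ Subgroup.center G := by
    intro p _ P
    refine Subgroup.centralizer_eq_top_iff_subset.1 ?_
    refine Subgroup.eq_top_of_forall_sylow_le fun q _ => ?_
    by_cases hpq : p = q
    · subst hpq
      have := hcon p ‹_› P
      exact ⟨P, Subgroup.le_centralizer _⟩
    · obtain ⟨Q⟩ : Nonempty (Sylow q G) := inferInstance
      exact ⟨Q, fun y hy => Subgroup.mem_centralizer_iff.2 fun x hx =>
        (P.commute_of_ne hpq Q hx hy)⟩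
  have htop : Subgroup.center G = ⊤ :=
    Subgroup.eq_top_of_forall_sylow_le fun p _ => ⟨default, hle p default⟩
  exact hnc ⟨⟨fun a b => (Subgroup.mem_center_iff.1 (htop ▸ Subgroup.mem_top b : b ∈ Subgroup.center G) a)⟩⟩

/-- A nilpotent noncommutative group in `GC*` has prime power order. -/
theorem IsGCStar.exists_isPGroup (hG : IsGCStar G) [Group.IsNilpotent G]
    (hnc : ¬ IsMulCommutative G) : ∃ (p : ℕ) (_ : Fact p.Prime), IsPGroup p G := by
  obtain ⟨p, hp, P, hP⟩ := exists_sylow_not_isMulCommutative hnc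
  refine ⟨p, hp, ?_⟩
  have htop : commutator G ⊔ (P : Subgroup G) = ⊤ := by
    refine Subgroup.eq_top_of_forall_sylow_le fun q _ => ?_
    by_cases hpq : p = q
    · subst hpq
      exact ⟨P, le_sup_right⟩
    · obtain ⟨Q⟩ : Nonempty (Sylow q G) := inferInstance
      -- `Q` is comparable to `G'`. If `G' ≤ Q`, then the commutators of `P` lie in `P ∩ Q = 1`,
      -- against the choice of `P`. Hence `Q ≤ G'`.
      refine ⟨Q, le_trans (hG.le_commutator_of_not_commutator_le _ fun hQ => hP ?_) le_sup_left⟩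
      refine ⟨⟨fun x y => Subtype.ext ?_⟩⟩
      have hmem : ⁅(x : G), (y : G)⁆ ∈ (Q : Subgroup G) :=
        hQ (Subgroup.commutator_mem_commutator (Subgroup.mem_top _) (Subgroup.mem_top _))
      have hmem' : ⁅(x : G), (y : G)⁆ ∈ (P : Subgroup G) := ⁅x, y⁆.2
      exact commutatorElement_eq_one_iff_mul_comm.1
        (Subgroup.disjoint_def.1 (IsPGroup.disjoint_of_ne p q hpq _ _ P.2 Q.2) hmem' hmem)
  have hPtop : (P : Subgroup G) = ⊤ := Subgroup.eq_top_of_commutator_sup htop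
  have := P.2
  change IsPGroup p (P : Subgroup G) at this
  rw [hPtop] at this
  exact this.of_equiv Subgroup.topEquiv

theorem IsGCStar.isCyclic_or_nonempty_mulEquiv (hG : IsGCStar G) [Group.IsNilpotent G]
    (hcyc : ∀ B : Subgroup G, IsMulCommutative B → IsCyclic B) :
    IsCyclic G ∨ Nonempty (G ≃* QuaternionGroup 2) := by
  by_cases hc : IsMulCommutative G
  · exact Or.inl (Subgroup.topEquiv.isCyclic.1 (hcyc ⊤ inferInstance))
  · obtain ⟨p, hp, hpG⟩ := hG.exists_isPGroup hc
    exact Or.inr (hG.nonempty_mulEquiv_quaternionGroup hpG hcyc hc)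

end NilpotentCase

/-! ### Fixed-point-free action and the Frobenius property -/

section Frobenius

variable {G : Type*} [Group G]

theorem Subgroup.IsComplement'.exists_mul {R L : Subgroup G} (h : R.IsComplement' L) (g : G) :
    ∃ k ∈ R, ∃ l ∈ L, k * l = g := by
  obtain ⟨⟨k, l⟩, hkl⟩ := h.2 g
  exact ⟨k, k.2, l, l.2, hkl⟩

/-- A semidirect product whose complement acts fixed-point-freely on the kernel is a Frobenius
group. -/
theorem isFrobeniusGroup_of_forall_commute [Finite G] {R L : Subgroup G} [R.Normal]
    (h : R.IsComplement' L) (hL : L ≠ ⊥) (hR : R ≠ ⊥)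
    (hfix : ∀ t ∈ L, t ≠ 1 → ∀ k ∈ R, Commute k t → k = 1) : IsFrobeniusGroup R L where
  ne_bot := hL
  ne_top := by
    rintro rfl
    exact hR (by simpa using h.disjoint)
  inf_conj g hg := by
    rw [eq_bot_iff]
    rintro x ⟨hx, y, hy, hyx⟩
    obtain ⟨k, hk, l, hl, rfl⟩ := h.exists_mul g
    replace hyx : k * l * y * (k * l)⁻¹ = x := hyx
    rw [Subgroup.mem_bot]
    by_contra hx1
    have hlyl : l * y * l⁻¹ ∈ L := mul_mem (mul_mem hl hy) (inv_mem hl)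
    -- Modulo `R`, the elements `x` and `l * y * l⁻¹` of `L` agree, so they are equal, and then `k`
    -- commutes with `x`.
    have hmem : (l * y * l⁻¹)⁻¹ * x ∈ R := by
      have : (l * y * l⁻¹)⁻¹ * x = ((l * y * l⁻¹)⁻¹ * k * (l * y * l⁻¹)) * k⁻¹ := by
        rw [← hyx]; group
      rw [this]
      refine mul_mem ?_ (inv_mem hk)
      simpa using (inferInstance : R.Normal).conj_mem k hk (l * y * l⁻¹)⁻¹
    have heq : l * y * l⁻¹ = x := inv_mul_eq_one.1
      (Subgroup.disjoint_def.1 h.disjoint hmem (mul_mem (inv_mem hlyl) hx))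
    have hcomm : Commute k x := by
      have : k * x * k⁻¹ = x := by
        conv_rhs => rw [← hyx]
        rw [← heq]; group
      exact mul_inv_eq_iff_eq_mul.1 this
    have hk1 := hfix x hx hx1 k hk hcomm
    rw [hk1, one_mul] at hg
    exact hg hl
  mem_kernel x := by
    constructor
    · intro hx
      refine or_iff_not_imp_left.2 fun hx1 g => ?_
      rintro ⟨y, hy, hyx⟩
      replace hyx : g * y * g⁻¹ = x := hyx
      have hyR : y ∈ R := by
        have : y = g⁻¹ * x * g⁻¹⁻¹ := by rw [← hyx]; group
        rw [this]
        exact (inferInstance : R.Normal).conj_mem x hx g⁻¹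
      have hy1 := Subgroup.disjoint_def.1 h.disjoint hyR hy
      exact hx1 (by rw [← hyx, hy1]; group)
    · rintro (rfl | hx)
      · exact one_mem R
      · by_contra hxR
        obtain ⟨k, hk, l, hl, rfl⟩ := h.exists_mul x
        have hl1 : l ≠ 1 := by
          rintro rfl
          exact hxR (by simpa using hk)
        have hmem : ∀ c : R, (c : G) * l * (c : G)⁻¹ * l⁻¹ ∈ R := by
          intro c
          have := mul_mem c.2 ((inferInstance : R.Normal).conj_mem _ (inv_mem c.2) l)
          simpa [mul_assoc] using this
        -- Injectivity of `c ↦ [c, l]` on the finite group `R` makes it surjective. Writing `k = [c,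
        -- l]` exhibits `k * l` as a conjugate of `l`.
        have hinj : Function.Injective fun c : R => (⟨_, hmem c⟩ : R) := by
          intro c d hcd
          have h1 : (c : G) * l * (c : G)⁻¹ * l⁻¹ = d * l * (d : G)⁻¹ * l⁻¹ :=
            congrArg Subtype.val hcd
          have h2 : (c : G) * l * (c : G)⁻¹ = d * l * (d : G)⁻¹ := mul_right_cancel h1
          have h3 : (d : G)⁻¹ * c = 1 := by
            refine hfix l hl hl1 _ (mul_mem (inv_mem d.2) c.2) ?_
            change (d : G)⁻¹ * c * l = l * ((d : G)⁻¹ * c)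
            have h4 : (c : G) * l = d * l * (d : G)⁻¹ * c := mul_inv_eq_iff_eq_mul.1 h2
            rw [mul_assoc, h4]; group
          exact Subtype.ext (inv_mul_eq_one.1 h3).symm
        obtain ⟨c, hc⟩ := (Finite.injective_iff_surjective.1 hinj) ⟨k, hk⟩
        have hc' : (c : G) * l * (c : G)⁻¹ * l⁻¹ = k := congrArg Subtype.val hc
        exact hx c ⟨l, hl, by
          change (c : G) * l * (c : G)⁻¹ = k * l
          rw [← hc']; group⟩

/-- All of `tR` is conjugate to `t`. The `L`-part of a conjugating element centralizes `t`, as seen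
modulo `R`, so conjugating by `R` alone suffices. Hence `c ↦ t⁻¹ c t c⁻¹` is surjective on `R`,
therefore injective, and `k` has the same image as `1`. -/
theorem IsGCStar.eq_one_of_commute [Finite G] (hG : IsGCStar G) {R L : Subgroup G} [R.Normal]
    (h : R.IsComplement' L) (hR : R ≤ commutator G) {t : G} (htL : t ∈ L) (ht : t ∉ commutator G)
    (hconj : ∀ y ∈ L, t⁻¹ * y ∈ commutator G → IsConj t y) {k : G} (hk : k ∈ R)
    (hkt : Commute k t) : k = 1 := by
  have hmem : ∀ c : R, t⁻¹ * ((c : G) * t * (c : G)⁻¹) ∈ R := by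
    intro c
    have := mul_mem ((inferInstance : R.Normal).conj_mem _ c.2 t⁻¹) (inv_mem c.2)
    simpa [mul_assoc] using this
  have hsurj : Function.Surjective fun c : R => (⟨_, hmem c⟩ : R) := by
    intro r
    obtain ⟨g, hg⟩ := isConj_iff.1 (hG.isConj_mul L ht htL hconj (hR r.2))
    obtain ⟨c, hc, l, hl, rfl⟩ := h.exists_mul g
    have h1 : t⁻¹ * (l * t * l⁻¹) ∈ R := by
      have h2 : t⁻¹ * (l * t * l⁻¹) = (t⁻¹ * c⁻¹ * t⁻¹⁻¹) * (r * c) := by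
        have : l * t * l⁻¹ = c⁻¹ * (t * r) * c := by rw [← hg]; group
        rw [this]; group
      rw [h2]
      exact mul_mem ((inferInstance : R.Normal).conj_mem _ (inv_mem hc) t⁻¹) (mul_mem r.2 hc)
    have h3 : t = l * t * l⁻¹ := inv_mul_eq_one.1 (Subgroup.disjoint_def.1 h.disjoint h1
      (mul_mem (inv_mem htL) (mul_mem (mul_mem hl htL) (inv_mem hl))))
    refine ⟨⟨c, hc⟩, Subtype.ext ?_⟩
    change t⁻¹ * (c * t * c⁻¹) = r
    have h4 : c * t * c⁻¹ = t * r := by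
      rw [← hg]
      conv_lhs => rw [h3]
      group
    rw [h4, inv_mul_cancel_left]
  have hinj := Finite.injective_iff_surjective.2 hsurj
  have := @hinj ⟨k, hk⟩ 1 (Subtype.ext (by
    change t⁻¹ * (k * t * k⁻¹) = t⁻¹ * (((1 : R) : G) * t * ((1 : R) : G)⁻¹)
    rw [hkt.eq]; simp))
  exact congrArg Subtype.val this

/-- On `C_R(z)` conjugation by `w` is an involutive automorphism without nontrivial fixed points,
and such an automorphism is inversion. -/
theorem conj_eq_inv_of_forall_commute [Finite G] {R : Subgroup G} [R.Normal] {w z : G}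
    (hwz : w * w = z) (hfix : ∀ k ∈ R, Commute k w → k = 1) {c : G} (hc : c ∈ R)
    (hcz : Commute c z) : w * c * w⁻¹ = c⁻¹ := by
  have hw : Commute w z := hwz ▸ (Commute.refl w).mul_right (Commute.refl w)
  let C : Subgroup G := R ⊓ Subgroup.centralizer {z}
  have hmem : ∀ x : C, w * x * w⁻¹ ∈ C := fun x =>
    ⟨(inferInstance : R.Normal).conj_mem _ x.2.1 w, Subgroup.mem_centralizer_singleton_iff.2
      ((hw.mul_left (Subgroup.mem_centralizer_singleton_iff.1 x.2.2)).mul_left hw.inv_left).eq⟩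
  let φ : C →* C := MonoidHom.mk' (fun x => ⟨w * x * w⁻¹, hmem x⟩) fun x y => Subtype.ext (by simp)
  have hφ : MonoidHom.FixedPointFree φ := fun x hx => Subtype.ext (hfix x x.2.1
    (mul_inv_eq_iff_eq_mul.1 (congrArg Subtype.val hx : w * x * w⁻¹ = x)).symm)
  have hφ2 : Function.Involutive φ := fun x => Subtype.ext (by
    change w * (w * x * w⁻¹) * w⁻¹ = x
    have hx : (x : G) * z = z * x := Subgroup.mem_centralizer_singleton_iff.1 x.2.2
    have : w * (w * x * w⁻¹) * w⁻¹ = z * x * z⁻¹ := by rw [← hwz]; group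
    rw [this, ← hx, mul_inv_cancel_right])
  have := congrFun (hφ.coe_eq_inv_of_involutive hφ2)
    ⟨c, hc, Subgroup.mem_centralizer_singleton_iff.2 hcz.eq⟩
  exact congrArg Subtype.val this

theorem QuaternionGroup.eq_of_mem_commutator {x : QuaternionGroup 2}
    (hx : x ∈ commutator (QuaternionGroup 2)) : x = 1 ∨ x = .a 2 := by
  have hle : commutator (QuaternionGroup 2) ≤ Subgroup.zpowers (.a 2) := by
    rw [commutator_def, Subgroup.commutator_le]
    intro x _ y _
    have : ∀ x y : QuaternionGroup 2, x * y * x⁻¹ * y⁻¹ = 1 ∨ x * y * x⁻¹ * y⁻¹ = .a 2 := by decide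
    rw [commutatorElement_def]
    rcases this x y with h | h <;> rw [h]
    · exact one_mem _
    · exact Subgroup.mem_zpowers _
  obtain ⟨n, rfl⟩ := Subgroup.mem_zpowers_iff.1 (hle hx)
  rcases Int.even_or_odd' n with ⟨m, rfl | rfl⟩
  · left
    rw [zpow_mul, show (QuaternionGroup.a 2 : QuaternionGroup 2) ^ (2 : ℤ) = 1 by decide, one_zpow]
  · right
    rw [zpow_add, zpow_mul, show (QuaternionGroup.a 2 : QuaternionGroup 2) ^ (2 : ℤ) = 1 by decide,
      one_zpow, one_mul, zpow_one]

theorem Subgroup.IsComplement'.exists_retraction {R L : Subgroup G} [R.Normal]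
    (h : R.IsComplement' L) : ∃ f : G →* L, f.ker = R ∧ ∀ l : L, f l = l := by
  refine ⟨h.symm.QuotientMulEquiv.toMonoidHom.comp (QuotientGroup.mk' R), ?_, fun l => ?_⟩
  · ext x
    simp
  · exact h.symm.QuotientMulEquiv.apply_symm_apply l

/-- Retracting `G` onto `L` shows that `L ∩ G'` lies in the centre of `Q₈`. A noncentral element of
`Q₈` is conjugate to its product with the central involution, so the coset criterion applies to it.
For the central involution, `i` and `j` both invert its centralizer in `R`, so `i * j` centralizes
that subgroup, and `i * j` is noncentral. -/
theorem IsGCStar.eq_one_of_commute_of_mulEquiv_quaternionGroup [Finite G] (hG : IsGCStar G)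
    {R L : Subgroup G} [R.Normal] (h : R.IsComplement' L) (hR : R ≤ commutator G)
    (e : L ≃* QuaternionGroup 2) {t : G} (ht : t ∈ L) (ht1 : t ≠ 1) {k : G} (hk : k ∈ R)
    (hkt : Commute k t) : k = 1 := by
  obtain ⟨f, -, hfL⟩ := h.exists_retraction
  have hcomm : ∀ l : L, (l : G) ∈ commutator G → e l = 1 ∨ e l = .a 2 := fun l hl => by
    refine QuaternionGroup.eq_of_mem_commutator ?_
    have h1 := Subgroup.mem_map_of_mem (e.toMonoidHom.comp f) hl
    rw [commutator_def, Subgroup.map_commutator] at h1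
    have h2 := Subgroup.commutator_mono le_top le_top h1
    simpa [hfL, commutator_def] using h2
  have hgen : ∀ l : L, e l ≠ 1 → e l ≠ .a 2 → ∀ k ∈ R, Commute k (l : G) → k = 1 := by
    intro l hl1 hl2 k hk hkl
    refine hG.eq_one_of_commute h hR l.2 (fun hl => (hcomm l hl).elim hl1 hl2) ?_ hk hkl
    intro y hy hly
    have h1 : e (l⁻¹ * ⟨y, hy⟩) = 1 ∨ e (l⁻¹ * ⟨y, hy⟩) = .a 2 := hcomm (l⁻¹ * ⟨y, hy⟩) hly
    have hdec : ∀ x y : QuaternionGroup 2, x ≠ 1 → x ≠ .a 2 → x⁻¹ * y = 1 ∨ x⁻¹ * y = .a 2 →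
        ∃ c, c * x * c⁻¹ = y := by decide
    rw [map_mul, map_inv] at h1
    obtain ⟨c, hc⟩ := hdec _ _ hl1 hl2 h1
    refine isConj_iff.2 ⟨(e.symm c : L), ?_⟩
    have h2 : e.symm c * l * (e.symm c)⁻¹ = ⟨y, hy⟩ := by
      apply e.injective
      simpa using hc
    exact congrArg Subtype.val h2
  by_cases hz : e ⟨t, ht⟩ = .a 2
  · set i := e.symm (.a 1) with hi
    set j := e.symm (.xa 0) with hj
    have hii : (i : G) * i = t := by
      have : i * i = ⟨t, ht⟩ := by
        apply e.injective
        rw [hz, map_mul, hi, e.apply_symm_apply]; decide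
      exact congrArg Subtype.val this
    have hjj : (j : G) * j = t := by
      have : j * j = ⟨t, ht⟩ := by
        apply e.injective
        rw [hz, map_mul, hj, e.apply_symm_apply]; decide
      exact congrArg Subtype.val this
    have h1 := conj_eq_inv_of_forall_commute hii (hgen i (by rw [hi, e.apply_symm_apply]; decide)
      (by rw [hi, e.apply_symm_apply]; decide)) hk hkt
    have h2 := conj_eq_inv_of_forall_commute hjj (hgen j (by rw [hj, e.apply_symm_apply]; decide)
      (by rw [hj, e.apply_symm_apply]; decide)) hk hkt
    refine hgen (i * j) ?_ ?_ k hk ?_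
    · rw [map_mul, hi, hj, e.apply_symm_apply, e.apply_symm_apply]; decide
    · rw [map_mul, hi, hj, e.apply_symm_apply, e.apply_symm_apply]; decide
    · have h3 : (i : G) * j * k * ((i : G) * j)⁻¹ = k := by
        have h4 : (i : G) * j * k * ((i : G) * j)⁻¹ = i * (j * k * (j : G)⁻¹) * (i : G)⁻¹ := by group
        have h5 : (i : G) * k⁻¹ * (i : G)⁻¹ = (i * k * (i : G)⁻¹)⁻¹ := by group
        rw [h4, h2, h5, h1, inv_inv]
      exact (mul_inv_eq_iff_eq_mul.1 h3).symm
  · refine hgen ⟨t, ht⟩ (fun h1 => ht1 ?_) hz k hk hkt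
    exact congrArg Subtype.val (e.map_eq_one_iff.1 h1)

/-- The retraction onto the abelian group `L` kills `G'`, so `L ∩ tG'` is just `{t}`. -/
theorem IsGCStar.eq_one_of_commute_of_isCyclic [Finite G] (hG : IsGCStar G)
    {R L : Subgroup G} [R.Normal] (h : R.IsComplement' L) (hR : R ≤ commutator G)
    [IsCyclic L] {t : G} (ht : t ∈ L) (ht1 : t ≠ 1) {k : G} (hk : k ∈ R)
    (hkt : Commute k t) : k = 1 := by
  obtain ⟨f, -, hfL⟩ := h.exists_retraction
  have hcomm : ∀ l : L, (l : G) ∈ commutator G → l = 1 := fun l hl => by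
    let : CommGroup L := IsCyclic.commGroup
    rw [← hfL l]
    exact f.eq_one_of_mem_commutator hl
  refine hG.eq_one_of_commute h hR ht (fun h1 => ht1 ?_) (fun y hy hty => ?_) hk hkt
  · exact congrArg Subtype.val (hcomm ⟨t, ht⟩ h1)
  · have h1 : (⟨t, ht⟩ : L)⁻¹ * ⟨y, hy⟩ = 1 := hcomm (⟨t, ht⟩⁻¹ * ⟨y, hy⟩) hty
    rw [show t = y from congrArg Subtype.val (inv_mul_eq_one.1 h1)]

end Frobenius

/-! ### Assembly of the main theorem -/

theorem proposition3p4 (G : Type*) [Group G] [Finite G] (hsolv : Group.IsSolvable G)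
    (hnil : ¬ Group.IsNilpotent G) (hG : IsGCStar G) :
    ∃ L : Subgroup G,
      IsFrobeniusGroup (nilpotentResidual G) L ∧
      (nilpotentResidual G).IsComplement' L ∧
      (IsCyclic L ∨ Nonempty (L ≃* QuaternionGroup 2)) := by
  have hR : nilpotentResidual G ≠ ⊥ := fun h => hnil (isNilpotent_iff_nilpotentResidual_eq_bot.2 h)
  obtain ⟨L, hL⟩ := Subgroup.exists_right_complement'_of_coprime
    (IsGCStar.coprime_card_index_nilpotentResidual _ G hG rfl)
  have e : G ⧸ nilpotentResidual G ≃* L := hL.symm.QuotientMulEquiv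
  have : Group.IsNilpotent (G ⧸ nilpotentResidual G) := (isNilpotent_quotient_iff _).2 le_rfl
  have : Group.IsNilpotent L := Group.nilpotent_of_mulEquiv e
  have hLG : IsGCStar L := (hG.quotient _).of_mulEquiv e
  have hLcyc : ∀ B : Subgroup L, IsMulCommutative B → IsCyclic B := by
    intro B hB
    have := hG.isCyclic_of_le_complement hR hL (B.map L.subtype) (Subgroup.map_subtype_le B)
    exact (B.equivMapOfInjective L.subtype L.subtype_injective).isCyclic.2 this
  have hcase := hLG.isCyclic_or_nonempty_mulEquiv hLcyc
  refine ⟨L, ?_, hL, hcase⟩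
  refine isFrobeniusGroup_of_forall_commute hL ?_ hR ?_
  -- With trivial `L` the residual would be all of `G`, yet it lies in the proper subgroup `G'`.
  · rintro rfl
    have : Nontrivial G := by
      by_contra h
      have := not_nontrivial_iff_subsingleton.1 h
      exact hR (Subsingleton.elim _ _)
    refine (Group.IsSolvable.commutator_lt_top_of_nontrivial G).not_ge ?_
    rw [← Subgroup.isComplement'_bot_right.1 hL]
    exact nilpotentResidual_le_commutator
  · intro t ht ht1 k hk hkt
    rcases hcase with hcyc | ⟨⟨e⟩⟩
    · exact hG.eq_one_of_commute_of_isCyclic hL nilpotentResidual_le_commutator ht ht1 hk hkt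
    · exact hG.eq_one_of_commute_of_mulEquiv_quaternionGroup hL nilpotentResidual_le_commutator e
        ht ht1 hk hkt
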